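/- Fix a countable set $\rho$ of roles, countably infinite disjoint sets of propositional variables $p$ and of nominals $i,j,\dots$, and a set of modal operators. Hybrid formulas are given by $\phi,\psi ::= \bot\mid p\mid i\mid \phi\wedge\psi\mid\neg\phi\mid \heartsuit(\phi_1,\dots,\phi_n)\mid @_i\phi$, and in the language with binder also $\downarrow i.\,\phi$. A (labelled) multigraph is a set $C$ with multiplicities $\gamma_r(c,d)\in\mathbb N\cup\{\infty\}$ ($r\in\rho$, $c,d\in C$). A model adds a valuation sending propositional variables to subsets of $C$ and nominals to elements of $C$; $@_i\phi$ says that $\phi$ holds at the state denoted by $i$, and $\downarrow i.\,\phi$ holds at $c$ iff $\phi$ holds at $c$ when $i$ is reinterpreted as $c$. Let $\#_r(\phi)$ denote, at a state $c$, the sum of $\gamma_r(c,d)$ over all states $d$ that satisfy $\phi$. *Graded hybrid logic* has the operators $\langle k\rangle_r\phi$, meaning $\#_r(\phi)>k$ ($k\in\mathbb N$). *Positive Presburger hybrid logic* has the operators $\sum_{s=1}^n a_s\cdot\#_r(\phi_s)\ge k$ with integers $n\ge1$, $a_s>0$, $k\ge 0$; here $\langle k\rangle_r\phi$ is $1\cdot\#_r(\phi)\ge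 k+1$. **Proof system.** Given a set $\mathcal A$ of pure formulas (no propositional variables) and a set $\Phi$ of global assumptions, $\Phi\vdash\phi$ means that $\phi$ is derivable, from finitely many elements $\Phi_0\subseteq\Phi$, using: * all instances of propositional tautologies, of $i\wedge\phi\to@_i\phi$, $\neg @_i\bot$, $\neg@_i\phi\leftrightarrow@_i\neg\phi$, $@_i(\phi\wedge\psi)\leftrightarrow(@_i\phi\wedge@_i\psi)$, $@_ii$, $@_ij\leftrightarrow@_ji$, $@_ij\wedge@_j\phi\to@_i\phi$, $@_i@_j\phi\leftrightarrow@_j\phi$, and $@_i\phi\to(\heartsuit(\psi_1,\dots,\psi_n)\leftrightarrow\heartsuit(@_i\phi\wedge\psi_1,\dots,@_i\phi\wedge\psi_n))$; * all instances of formulas in $\mathcal A$ under substitutions of nominals for nominals; * in the language with binder, $(\mathsf{DA})$: $@_i((\downarrow j.\,\phi)\leftrightarrow\phi[i/j])$; * modus ponens and $@$-generalization $\phi/@_i\phi$; * the one-step rules: let $(\heartsuit_x)_{x\in\Gamma\cup\Delta}$ be a finite family of operators for the same role, where $\heartsuit_x$ says $\sum_s a_{xs}\#_r(\_)\ge k_x$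 (in the graded case $\langle k\rangle_r$ is read as $1\cdot\#_r(\_)\ge k+1$), with weights $w_x\in\mathbb N$ such that $\sum_{\Delta}w_x(k_x-1)<\sum_{\Gamma}w_xk_x$. From a propositional combination of formulas $\phi_{xs}$ that propositionally forces $\sum_{x\in\Gamma}w_x\sum_s a_{xs}[\phi_{xs}]\le\sum_{x\in\Delta}w_x\sum_sa_{xs}[\phi_{xs}]$ (where $[\cdot]\in\{0,1\}$ denotes truth values), infer $\bigwedge_{x\in\Gamma}\heartsuit_x(\phi_{xs})_s\to\bigvee_{x\in\Delta}\heartsuit_x(\phi_{xs})_s$; * $(\mathsf{Name})$: from $i\to\phi$ infer $\phi$, where $i$ is fresh; * $(\mathsf{Paste})$: in the graded case, from $@_{j_1}\phi\wedge\dots\wedge@_{j_{k+1}}\phi\wedge@_i\langle k\rangle_r(j_1\vee\dots\vee j_{k+1})\to\psi$ infer $@_i\langle k\rangle_r\phi\to\psi$, where the $j_t$ are fresh and pairwise distinct. In the Presburger case, for $\heartsuit$ with threshold $k$ and $n$ arguments, with pairwise distinct fresh nominals $j_{s,t}$ ($s\le n$, $t\le k$), infer $@_i\heartsuit(\phi_1,\dots,\phi_n)\to\psi$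 from all the premises $\bigwedge_{s\in S,\,t\le k}@_{j_{s,t}}\phi_s\wedge@_i\heartsuit(\chi_1,\dots,\chi_n)\to\psi$ with $\emptyset\neq S\subseteq\{1,\dots,n\}$, where $\chi_s=\bigvee_{t\le k}j_{s,t}$ for $s\in S$ and $\chi_s=\bot$ otherwise. Fresh means: not occurring in the other formulas and nominals of the conclusion of the rule, nor in $\Phi_0$. One writes $\Phi;\Psi\vdash\phi$ if $\Phi\vdash\psi_1\wedge\dots\wedge\psi_m\to\phi$ for some $\psi_1,\dots,\psi_m\in\Psi$; and $\Phi;\Psi\models^{\mathcal C}\phi$ if for every model in $\mathcal C$ in which all formulas in $\Phi$ hold at all states, $\phi$ holds at every state at which all formulas in $\Psi$ hold. A frame is an $\mathcal A$-frame if all formulas in $\mathcal A$ hold at all states under all valuations. **Theorem.** Consider either the language without or the language with $\downarrow$. 1. For graded hybrid logic, for positive Presburger hybrid logic, and for every set $\mathcal A$ of pure formulas, the system is sound and globally and locally strongly complete: for all sets $\Phi,\Psi$ of formulas and all formulas $\phi$, $\Phi;\Psi\vdash\phi$ iff $\Phi;\Psi\models^{\mathcal C}\phi$, both for $\mathcal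 C$ the class of models based on $\mathcal A$-frames and for $\mathcal C$ the class of countable such models. 2. In both logics, for each role $r$, the following axioms are pure and define the following classes of multigraphs: $\neg\langle1\rangle_ri$ defines the Kripke frames ($\gamma_r(c,d)\le1$); $i\to\langle0\rangle_ri$ the reflexive multigraphs ($\gamma_r(c,c)>0$); $\langle0\rangle_r\langle n\rangle_ri\to\langle n\rangle_ri$ ($n\ge0$) the transitive ones ($\gamma_r(c,d)>0$ implies $\gamma_r(d,e)\le\gamma_r(c,e)$); $i\wedge\langle k\rangle_rj\to@_j\langle k\rangle_ri$ ($k\ge 0$) the symmetric ones ($\gamma_r(c,d)=\gamma_r(d,c)$). 3. Interpret the graded language over Kripke frames (a binary relation for each role), $\langle k\rangle_r\phi$ meaning that more than $k$ $r$-successors satisfy $\phi$. It then contains the concepts of the description logic $\mathcal{SHOQ}$ (concept names, nominals, Boolean connectives, $\exists r.D$, $\forall r.D$, $\ge n\,r.D$, $\le n\,r.D$) under the evident truth-preserving translation. For every role box $H$ (a set of role inclusions $r\sqsubseteq s$ and transitivity assertions), the pure axioms $\neg\langle1\rangle_ri$ for all roles $r$, $\langle0\rangle_ri\to\langle0\rangle_si$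 for $r\sqsubseteq s$ in $H$, and $\langle0\rangle_r\langle n\rangle_ri\to\langle n\rangle_ri$ ($n\ge0$) for each $r$ declared transitive in $H$, are valid in exactly those Kripke frames that respect $H$. For every set $\mathcal A$ of further pure axioms, the graded system with these axioms and $\mathcal A$ is sound and globally and locally strongly complete, in the sense of 1, over the Kripke $\mathcal A$-frames that respect $H$, and over the countable ones among them. This is a complete axiomatization of an extension of $\mathcal{SHOQ}$ with satisfaction operators and, in the language with binder, $\downarrow$. -/

import Mathlib

universe u

namespace HybridLogic

/-! ### Syntax of hybrid logic over a modal similarity type -/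

/-- A modal similarity type: operators with arities. -/
structure SimType where
  Op : Type
  ar : Op → ℕ

/-- State labels available below `n` binders: nominals (`Sum.inl i`), or the state variable bound
by one of the `n` enclosing binders (`Sum.inr x`, where `x = 0` is the innermost one). -/
abbrev Lbl (n : ℕ) : Type := ℕ ⊕ Fin n

/-- Hybrid formulas, up to renaming of bound variables. Propositional variables and nominals are
two copies of `ℕ`. The parameter `b` says whether the language has the binder `↓`: the formulas
of the language without `↓` are the elements of `Form Λ false 0`, those of the language with `↓`
are the elements of `Form Λ true 0`. -/
inductive Form (Λ : SimType) (b : Bool) : ℕ → Type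
  | bot {n : ℕ} : Form Λ b n
  | prop {n : ℕ} (p : ℕ) : Form Λ b n
  | lab {n : ℕ} (l : Lbl n) : Form Λ b n
  | and {n : ℕ} (φ ψ : Form Λ b n) : Form Λ b n
  | neg {n : ℕ} (φ : Form Λ b n) : Form Λ b n
  | op {n : ℕ} (o : Λ.Op) (φ : Fin (Λ.ar o) → Form Λ b n) : Form Λ b n
  | atL {n : ℕ} (l : Lbl n) (φ : Form Λ b n) : Form Λ b n
  | down {n : ℕ} (hb : b = true) (φ : Form Λ b (n + 1)) : Form Λ b n

/-- Extension of a relabelling below one more binder. -/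
def liftLbl {m n : ℕ} (f : Lbl m → Lbl n) : Lbl (m + 1) → Lbl (n + 1) :=
  Sum.elim (fun i => Sum.map id Fin.succ (f (Sum.inl i)))
    (Fin.cases (Sum.inr 0) (fun x => Sum.map id Fin.succ (f (Sum.inr x))))

namespace Form

variable {Λ : SimType} {b : Bool}

/-- Relabelling of free labels. -/
def map : {m n : ℕ} → (Lbl m → Lbl n) → Form Λ b m → Form Λ b n
  | _, _, _, bot => bot
  | _, _, _, prop p => prop p
  | _, _, f, lab l => lab (f l)
  | _, _, f, and φ ψ => and (map f φ) (map f ψ)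
  | _, _, f, neg φ => neg (map f φ)
  | _, _, f, op o φ => op o (fun s => map f (φ s))
  | _, _, f, atL l φ => atL (f l) (map f φ)
  | _, _, f, down hb φ => down hb (map (liftLbl f) φ)

/-- The substitution instance of a formula under a substitution of nominals for nominals. -/
def rename (τ : ℕ → ℕ) (φ : Form Λ b 0) : Form Λ b 0 := map (Sum.map τ id) φ

/-- `φ[i/j]`, where `j` is the variable bound by the outermost binder of `↓ j. φ`. -/
def inst (φ : Form Λ b 1) (i : ℕ) : Form Λ b 0 := map (Sum.elim Sum.inl (fun _ => Sum.inl i)) φ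

/-- The nominals occurring in a formula. -/
def noms : {n : ℕ} → Form Λ b n → Set ℕ
  | _, bot => ∅
  | _, prop _ => ∅
  | _, lab l => {i | l = Sum.inl i}
  | _, and φ ψ => noms φ ∪ noms ψ
  | _, neg φ => noms φ
  | _, op _ φ => ⋃ s, noms (φ s)
  | _, atL l φ => {i | l = Sum.inl i} ∪ noms φ
  | _, down _ φ => noms φ

/-- A formula is pure if it contains no propositional variables. -/
def IsPure : {n : ℕ} → Form Λ b n → Prop
  | _, bot => True
  | _, prop _ => False
  | _, lab _ => True
  | _, and φ ψ => IsPure φ ∧ IsPure ψ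
  | _, neg φ => IsPure φ
  | _, op _ φ => ∀ s, IsPure (φ s)
  | _, atL _ φ => IsPure φ
  | _, down _ φ => IsPure φ

variable {n : ℕ}

def nom (i : ℕ) : Form Λ b n := lab (Sum.inl i)

def atN (i : ℕ) (φ : Form Λ b n) : Form Λ b n := atL (Sum.inl i) φ

def top : Form Λ b n := neg bot

def or (φ ψ : Form Λ b n) : Form Λ b n := neg (and (neg φ) (neg ψ))

def imp (φ ψ : Form Λ b n) : Form Λ b n := neg (and φ (neg ψ))

def iff (φ ψ : Form Λ b n) : Form Λ b n := and (imp φ ψ) (imp ψ φ)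

def bigAnd : List (Form Λ b n) → Form Λ b n
  | [] => top
  | φ :: l => and φ (bigAnd l)

def bigOr : List (Form Λ b n) → Form Λ b n
  | [] => bot
  | φ :: l => or φ (bigOr l)

end Form

/-! ### Propositional formulas and one-step rules -/

/-- `Prop(Z)`: propositional combinations of elements of `Z`. -/
inductive PForm (Z : Type) : Type
  | bot : PForm Z
  | var (z : Z) : PForm Z
  | and (φ ψ : PForm Z) : PForm Z
  | neg (φ : PForm Z) : PForm Z

namespace PForm

variable {Z : Type}

def eval (v : Z → Bool) : PForm Z → Bool
  | bot => false
  | var z => v z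
  | and φ ψ => eval v φ && eval v ψ
  | neg φ => !(eval v φ)

def Taut (φ : PForm Z) : Prop := ∀ v : Z → Bool, φ.eval v = true

def subst {Λ : SimType} {b : Bool} (σ : Z → Form Λ b 0) : PForm Z → Form Λ b 0
  | bot => Form.bot
  | var z => σ z
  | and φ ψ => Form.and (subst σ φ) (subst σ ψ)
  | neg φ => Form.neg (subst σ φ)

def or (φ ψ : PForm Z) : PForm Z := neg (and (neg φ) (neg ψ))

def imp (φ ψ : PForm Z) : PForm Z := neg (and φ (neg ψ))

def bigAnd : List (PForm Z) → PForm Z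
  | [] => neg bot
  | φ :: l => and φ (bigAnd l)

def bigOr : List (PForm Z) → PForm Z
  | [] => bot
  | φ :: l => or φ (bigOr l)

end PForm

/-- `Λ(P)`: modal operators applied to propositional variables. -/
abbrev SimType.Modal (Λ : SimType) : Type := (o : Λ.Op) × (Fin (Λ.ar o) → ℕ)

/-- One-step rules `φ / ψ` with `φ ∈ Prop(P)` and `ψ ∈ Prop(Λ(P))`. -/
structure OneStepRule (Λ : SimType) where
  prem : PForm ℕ
  concl : PForm Λ.Modal

/-- The data that determine the proof system of a bounded logic: a set of one-step rules, and for
each operator `♥` the number `k` for which the paste rule `Paste♥(k)` is used. -/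
structure Axiomatization (Λ : SimType) where
  rules : Set (OneStepRule Λ)
  bound : Λ.Op → ℕ

/-! ### The Hilbert system -/

section
open Form

variable {Λ : SimType} {b : Bool}

/-- The local part of the premise of a paste rule for `@_i ♥(φ₁, …, φₙ)`, with nominals `j s r`,
relative to a set `S` of arguments of `♥`:
`⋀_{s ∈ S} ⋀_r @_{j s r} φ_s ∧ @_i ♥(χ₁, …, χₙ)`, where `χ_s` is `⋁_r j s r` for `s ∈ S` and `⊥`
for `s ∉ S`. For unary `♥` the only nonempty `S` contains the single argument, and this is
`@_{j_1} φ ∧ … ∧ @_{j_k} φ ∧ @_i ♥(j_1 ∨ … ∨ j_k)`. -/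
def pasteHyp (o : Λ.Op) (k : ℕ) (φ : Fin (Λ.ar o) → Form Λ b 0) (i : ℕ)
    (j : Fin (Λ.ar o) → Fin k → ℕ) (S : Finset (Fin (Λ.ar o))) : Form Λ b 0 :=
  and
    (bigAnd ((List.finRange (Λ.ar o)).flatMap fun s =>
      if s ∈ S then List.ofFn (fun r => atN (j s r) (φ s)) else []))
    (atN i (op o fun s => if s ∈ S then bigOr (List.ofFn fun r => nom (j s r)) else bot))

/-- Derivability in the system with one-step rules, pure axioms `A`, `Name`, `Paste` and (if the
language has the binder) `DA`, where all elements of `Φ` are used as global assumptions.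
Fresh nominals must not occur in `Φ`. -/
inductive Der (L : Axiomatization Λ) (A Φ : Set (Form Λ b 0)) : Form Λ b 0 → Prop
  | hyp (φ : Form Λ b 0) : φ ∈ Φ → Der L A Φ φ
  | taut (φ : PForm ℕ) (σ : ℕ → Form Λ b 0) : φ.Taut → Der L A Φ (φ.subst σ)
  | atIntro (i : ℕ) (φ : Form Λ b 0) : Der L A Φ (imp (and (nom i) φ) (atN i φ))
  | mob (i : ℕ) (φ : Form Λ b 0) (o : Λ.Op) (ψ : Fin (Λ.ar o) → Form Λ b 0) :
      Der L A Φ (imp (atN i φ) (iff (op o ψ) (op o fun s => and (atN i φ) (ψ s))))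
  | atBot (i : ℕ) : Der L A Φ (neg (atN i bot))
  | atNeg (i : ℕ) (φ : Form Λ b 0) : Der L A Φ (iff (neg (atN i φ)) (atN i (neg φ)))
  | atAnd (i : ℕ) (φ ψ : Form Λ b 0) :
      Der L A Φ (iff (atN i (and φ ψ)) (and (atN i φ) (atN i ψ)))
  | atRefl (i : ℕ) : Der L A Φ (atN i (nom i))
  | atSymm (i j : ℕ) : Der L A Φ (iff (atN i (nom j)) (atN j (nom i)))
  | atNom (i j : ℕ) (φ : Form Λ b 0) :
      Der L A Φ (imp (and (atN i (nom j)) (atN j φ)) (atN i φ))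
  | atAgree (i j : ℕ) (φ : Form Λ b 0) : Der L A Φ (iff (atN i (atN j φ)) (atN j φ))
  | pureAx (α : Form Λ b 0) (τ : ℕ → ℕ) : α ∈ A → Der L A Φ (α.rename τ)
  | da (hb : b = true) (i : ℕ) (φ : Form Λ b 1) :
      Der L A Φ (atN i (iff (down hb φ) (φ.inst i)))
  | mp (φ ψ : Form Λ b 0) : Der L A Φ (imp φ ψ) → Der L A Φ φ → Der L A Φ ψ
  | atGen (i : ℕ) (φ : Form Λ b 0) : Der L A Φ φ → Der L A Φ (atN i φ)
  | rule (R : OneStepRule Λ) (σ : ℕ → Form Λ b 0) : R ∈ L.rules →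
      Der L A Φ (R.prem.subst σ) →
      Der L A Φ (R.concl.subst fun x => op x.1 fun s => σ (x.2 s))
  | name (i : ℕ) (φ : Form Λ b 0) : i ∉ φ.noms → (∀ χ ∈ Φ, i ∉ χ.noms) →
      Der L A Φ (imp (nom i) φ) → Der L A Φ φ
  | paste (o : Λ.Op) (φ : Fin (Λ.ar o) → Form Λ b 0) (i : ℕ) (ψ : Form Λ b 0)
      (j : Fin (Λ.ar o) → Fin (L.bound o) → ℕ) :
      (∀ s s' r r', j s r = j s' r' → s = s' ∧ r = r') →
      (∀ s r, j s r ≠ i ∧ (∀ t, j s r ∉ (φ t).noms) ∧ j s r ∉ ψ.noms ∧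
        ∀ χ ∈ Φ, j s r ∉ χ.noms) →
      (∀ S : Finset (Fin (Λ.ar o)), S.Nonempty →
        Der L A Φ (imp (pasteHyp o (L.bound o) φ i j S) ψ)) →
      Der L A Φ (imp (atN i (op o φ)) ψ)

/-- Derivability from an arbitrary set `Φ` of global assumptions: a derivation uses only finitely
many elements of `Φ`, and fresh nominals must not occur in those. -/
def Derives (L : Axiomatization Λ) (A Φ : Set (Form Λ b 0)) (φ : Form Λ b 0) : Prop :=
  ∃ Φ₀ : Set (Form Λ b 0), Φ₀ ⊆ Φ ∧ Φ₀.Finite ∧ Der L A Φ₀ φ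

/-- `Φ; Ψ ⊢ φ`: derivability from global assumptions `Φ` and local assumptions `Ψ`. -/
def DerivesLoc (L : Axiomatization Λ) (A Φ Ψ : Set (Form Λ b 0)) (φ : Form Λ b 0) : Prop :=
  ∃ l : List (Form Λ b 0), (∀ ψ ∈ l, ψ ∈ Ψ) ∧ Derives L A Φ (imp (bigAnd l) φ)

end

/-! ### Semantics -/

/-- Interpretation of the operators over `T`-coalgebras: the action of `T` on sets, and for each
`n`-ary operator and each set `X` a map from `n`-tuples of subsets of `X` to subsets of `T X`. -/
structure Sem (Λ : SimType) where
  T : Type u → Type u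
  lifting : (o : Λ.Op) → {X : Type u} → (Fin (Λ.ar o) → Set X) → Set (T X)

section
variable {Λ : SimType} {b : Bool} (S : Sem.{u} Λ)

/-- Assignment of states to labels obtained by binding the innermost variable to `c`. -/
def bindLbl {n : ℕ} {C : Type u} (g : Lbl n → C) (c : C) : Lbl (n + 1) → C :=
  Sum.elim (fun i => g (Sum.inl i)) (Fin.cases c (fun x => g (Sum.inr x)))

/-- Satisfaction at a state `c` of the coalgebra `(C, γ)`, where `V` interprets propositional
variables and `g` interprets the free labels. -/
def Sat {C : Type u} (γ : C → S.T C) (V : ℕ → Set C) :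
    {n : ℕ} → (Lbl n → C) → Form Λ b n → C → Prop
  | _, _, .bot, _ => False
  | _, _, .prop p, c => c ∈ V p
  | _, g, .lab l, c => c = g l
  | _, g, .and φ ψ, c => Sat γ V g φ c ∧ Sat γ V g ψ c
  | _, g, .neg φ, c => ¬ Sat γ V g φ c
  | _, g, .op o φ, c => γ c ∈ S.lifting o (fun s => {d | Sat γ V g (φ s) d})
  | _, g, .atL l φ, _ => Sat γ V g φ (g l)
  | _, g, .down _ φ, c => Sat γ V (bindLbl g c) φ c

/-- `(C, γ, V), c ⊨ φ`, where the hybrid valuation consists of `V` on propositional variables and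
`ν` on nominals. -/
def Holds {C : Type u} (γ : C → S.T C) (V : ℕ → Set C) (ν : ℕ → C) (φ : Form Λ b 0) (c : C) :
    Prop :=
  Sat S γ V (Sum.elim ν Fin.elim0) φ c

/-- `(C, γ)` is an `A`-frame. -/
def IsFrame {C : Type u} (γ : C → S.T C) (A : Set (Form Λ b 0)) : Prop :=
  ∀ (V : ℕ → Set C) (ν : ℕ → C), ∀ α ∈ A, ∀ c, Holds S γ V ν α c

/-- `φ` is a local consequence of `Ψ` under global assumptions `Φ`, for models based on frames in
the class `K`. -/
def Conseq (K : ∀ C : Type u, (C → S.T C) → Prop) (Φ Ψ : Set (Form Λ b 0))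
    (φ : Form Λ b 0) : Prop :=
  ∀ (C : Type u) (γ : C → S.T C), K C γ → ∀ (V : ℕ → Set C) (ν : ℕ → C),
    (∀ χ ∈ Φ, ∀ d, Holds S γ V ν χ d) →
    ∀ c, (∀ ψ ∈ Ψ, Holds S γ V ν ψ c) → Holds S γ V ν φ c

/-- The system given by `L` and the pure axioms `A` is sound and globally and locally strongly
complete, both over all models based on frames in `K` and over the countable ones among them. -/
def StronglyCompleteFor (L : Axiomatization Λ) (A : Set (Form Λ b 0))
    (K : ∀ C : Type u, (C → S.T C) → Prop) : Prop :=
  ∀ (Φ Ψ : Set (Form Λ b 0)) (φ : Form Λ b 0),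
    (DerivesLoc L A Φ Ψ φ ↔ Conseq S K Φ Ψ φ) ∧
    (DerivesLoc L A Φ Ψ φ ↔ Conseq S (fun C γ => Countable C ∧ K C γ) Φ Ψ φ)

end

/-! ### Multigraphs, graded hybrid logic, positive Presburger hybrid logic -/

/-- The sum of the multiplicities of the elements of `Y` in the multiset `B`. -/
noncomputable def weight {X : Type u} (B : X → ℕ∞) (Y : Set X) : ℕ∞ :=
  ⨆ F : Finset X, ⨆ _ : (F : Set X) ⊆ Y, ∑ x ∈ F, B x

/-- One-step rules for operators `♥` that say `∑ₛ coeff ♥ s · #(φₛ) ≥ thr ♥` about the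
`role ♥`-successors. For finite families of operators `♥ₓ` (`x` in `Γ` or `Δ`, all for the same
role), with nonnegative integer weights `wₓ`, the rule derives `⋀_Γ ♥ₓ(aₓ) → ⋁_Δ ♥ₓ(aₓ)` from any
propositional premise that forces
`∑_Γ wₓ ∑ₛ coeff ♥ₓ s · aₓₛ ≤ ∑_Δ wₓ ∑ₛ coeff ♥ₓ s · aₓₛ`
between truth values `0, 1`, provided that `∑_Δ wₓ (thr ♥ₓ - 1) < ∑_Γ wₓ thr ♥ₓ`. -/
def countingRules {ρ : Type} (Λ : SimType) (role : Λ.Op → ρ) (coeff : ∀ o, Fin (Λ.ar o) → ℕ)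
    (thr : Λ.Op → ℕ) : Set (OneStepRule Λ) :=
  {R | ∃ (r : ρ) (Γ Δ : List (ℕ × Λ.Modal)),
    (∀ x ∈ Γ ++ Δ, role x.2.1 = r) ∧
    (∀ v : ℕ → Bool, R.prem.eval v = true →
      (Γ.map fun x => x.1 * ∑ s, coeff x.2.1 s * (v (x.2.2 s)).toNat).sum ≤
        (Δ.map fun x => x.1 * ∑ s, coeff x.2.1 s * (v (x.2.2 s)).toNat).sum) ∧
    (Δ.map fun x => x.1 * thr x.2.1).sum <
      (Γ.map fun x => x.1 * thr x.2.1).sum + (Δ.map fun x => x.1).sum ∧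
    R.concl = PForm.imp (PForm.bigAnd (Γ.map fun x => PForm.var x.2))
      (PForm.bigOr (Δ.map fun x => PForm.var x.2))}

section
variable (ρ : Type)

/-- Graded operators `⟨k⟩_r` (`r` a role, `k ∈ ℕ`): "in more than `k` `r`-successors". -/
def gradedSig : SimType where
  Op := ρ × ℕ
  ar := fun _ => 1

/-- Graded logic over multigraphs with edges labelled by roles, i.e. coalgebras for
`X ↦ (ρ → X → ℕ ∪ {∞})`. -/
noncomputable def gradedSem : Sem.{u} (gradedSig ρ) where
  T := fun X => ρ → X → ℕ∞
  lifting := fun o _ Y => {B | (o.2 : ℕ∞) < weight (B o.1) (Y (0 : Fin 1))}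

/-- `⟨k⟩_r` is `(k + 1)`-bounded. -/
def gradedAx : Axiomatization (gradedSig ρ) where
  rules := countingRules (gradedSig ρ) (fun o => o.1) (fun _ _ => 1) (fun o => o.2 + 1)
  bound := fun o => o.2 + 1

/-- Positive Presburger operators `∑_{s ≤ n} a_s · #_r(_s) ≥ k` with all `a_s > 0`. -/
structure PresOp where
  role : ρ
  n : ℕ
  coeff : Fin (n + 1) → ℕ+
  thr : ℕ

def presSig : SimType where
  Op := PresOp ρ
  ar := fun o => o.n + 1

noncomputable def presSem : Sem.{u} (presSig ρ) where
  T := fun X => ρ → X → ℕ∞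
  lifting := fun o _ Y =>
    {B | (o.thr : ℕ∞) ≤ ∑ s : Fin (o.n + 1), ((o.coeff s : ℕ) : ℕ∞) * weight (B o.role) (Y s)}

/-- `∑ a_s · #_r(_s) ≥ k` is `k`-bounded. -/
def presAx : Axiomatization (presSig ρ) where
  rules := countingRules (presSig ρ) (fun o => o.role) (fun o s => (o.coeff s : ℕ))
    (fun o => o.thr)
  bound := fun o => o.thr

end

section
variable {ρ : Type} {b : Bool}

def gradedDia (r : ρ) (k : ℕ) (φ : Form (gradedSig ρ) b 0) : Form (gradedSig ρ) b 0 :=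
  .op (Λ := gradedSig ρ) (r, k) (fun _ => φ)

/-- `⟨k⟩_r φ` as the Presburger formula `1 · #_r(φ) ≥ k + 1`. -/
def presDia (r : ρ) (k : ℕ) (φ : Form (presSig ρ) b 0) : Form (presSig ρ) b 0 :=
  .op (Λ := presSig ρ) ⟨r, 0, fun _ => 1, k + 1⟩ (fun _ => φ)

end

/-! ### Pure axioms for frame classes -/

section
open Form

variable {ρ : Type} {Λ : SimType} {b : Bool} (dia : ρ → ℕ → Form Λ b 0 → Form Λ b 0) (r : ρ)

/-- `¬ ⟨1⟩ i` -/
def kripkeAx : Set (Form Λ b 0) := {neg (dia r 1 (nom 0))}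

/-- `i → ⟨0⟩ i` -/
def reflAx : Set (Form Λ b 0) := {imp (nom 0) (dia r 0 (nom 0))}

/-- `⟨0⟩ ⟨n⟩ i → ⟨n⟩ i`, `n ≥ 0` -/
def transAx : Set (Form Λ b 0) :=
  Set.range fun n : ℕ => imp (dia r 0 (dia r n (nom 0))) (dia r n (nom 0))

/-- `i ∧ ⟨k⟩ j → @_j ⟨k⟩ i`, `k ≥ 0` -/
def symmAx : Set (Form Λ b 0) :=
  Set.range fun k : ℕ => imp (and (nom 0) (dia r k (nom 1))) (atN 1 (dia r k (nom 0)))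

/-- `⟨0⟩_r i → ⟨0⟩_s i` -/
def inclAx (r s : ρ) : Set (Form Λ b 0) := {imp (dia r 0 (nom 0)) (dia s 0 (nom 0))}

/-- The axioms above are pure and define, respectively, the classes of multigraphs whose
`r`-edges are Kripke, reflexive, transitive, symmetric. Here `S` interprets formulas over
multigraphs `γ : C → ρ → C → ℕ ∪ {∞}`. -/
def DefinesFrameClasses
    (frame : ∀ {C : Type u}, (C → ρ → C → ℕ∞) → Set (Form Λ b 0) → Prop) : Prop :=
  ∀ r : ρ,
    (∀ α ∈ kripkeAx dia r ∪ reflAx dia r ∪ transAx dia r ∪ symmAx dia r, α.IsPure) ∧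
    ∀ (C : Type u) (γ : C → ρ → C → ℕ∞),
      (frame γ (kripkeAx dia r) ↔ ∀ c d, γ c r d ≤ 1) ∧
      (frame γ (reflAx dia r) ↔ ∀ c, 0 < γ c r c) ∧
      (frame γ (transAx dia r) ↔ ∀ c d e, 0 < γ c r d → γ d r e ≤ γ c r e) ∧
      (frame γ (symmAx dia r) ↔ ∀ c d, γ c r d = γ d r c)

end

/-! ### The description logic SHOQ -/

/-- Axioms of a role box: role inclusions and transitivity assertions. -/
inductive RoleAxiom (ρ : Type) : Type
  | incl (r s : ρ) : RoleAxiom ρ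
  | trans (r : ρ) : RoleAxiom ρ

/-- `γ c r` is the set of `r`-successors of `c`. -/
def RoleAxiom.Respected {ρ : Type} {C : Type u} (γ : C → ρ → Set C) : RoleAxiom ρ → Prop
  | incl r s => ∀ c, γ c r ⊆ γ c s
  | trans r => ∀ c d e, d ∈ γ c r → e ∈ γ d r → e ∈ γ c r

/-- Graded logic over Kripke frames: `⟨k⟩_r φ` holds at a state if more than `k` of its
`r`-successors satisfy `φ`. -/
noncomputable def kripkeSem (ρ : Type) : Sem.{u} (gradedSig ρ) where
  T := fun X => ρ → Set X
  lifting := fun o _ Y => {B | (o.2 : ℕ∞) < (B o.1 ∩ Y (0 : Fin 1)).encard}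

/-- The pure axioms for a single role axiom. -/
def RoleAxiom.axioms {ρ : Type} {b : Bool} : RoleAxiom ρ → Set (Form (gradedSig ρ) b 0)
  | incl r s => inclAx gradedDia r s
  | trans r => transAx gradedDia r

/-- The pure axioms for a role box over Kripke frames. -/
def roleBoxAx {ρ : Type} {b : Bool} (H : Set (RoleAxiom ρ)) : Set (Form (gradedSig ρ) b 0) :=
  (⋃ r, kripkeAx gradedDia r) ∪ ⋃ a ∈ H, a.axioms

/-- Concept descriptions of SHOQ: concept names, nominals, Boolean connectives, existential and
universal restrictions, qualified number restrictions. -/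
inductive SHOQConcept (ρ : Type) : Type
  | top : SHOQConcept ρ
  | bot : SHOQConcept ρ
  | atom (p : ℕ) : SHOQConcept ρ
  | one (i : ℕ) : SHOQConcept ρ
  | compl (D : SHOQConcept ρ) : SHOQConcept ρ
  | inter (D E : SHOQConcept ρ) : SHOQConcept ρ
  | union (D E : SHOQConcept ρ) : SHOQConcept ρ
  | ex (r : ρ) (D : SHOQConcept ρ) : SHOQConcept ρ
  | all (r : ρ) (D : SHOQConcept ρ) : SHOQConcept ρ
  | atLeast (n : ℕ) (r : ρ) (D : SHOQConcept ρ) : SHOQConcept ρ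
  | atMost (n : ℕ) (r : ρ) (D : SHOQConcept ρ) : SHOQConcept ρ

namespace SHOQConcept

variable {ρ : Type}

/-- The extension of a concept in an interpretation with domain `C`. -/
def ext {C : Type u} (γ : C → ρ → Set C) (V : ℕ → Set C) (ν : ℕ → C) : SHOQConcept ρ → Set C
  | top => Set.univ
  | bot => ∅
  | atom p => V p
  | one i => {ν i}
  | compl D => (ext γ V ν D)ᶜ
  | inter D E => ext γ V ν D ∩ ext γ V ν E
  | union D E => ext γ V ν D ∪ ext γ V ν E
  | ex r D => {c | ∃ d ∈ γ c r, d ∈ ext γ V ν D}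
  | all r D => {c | ∀ d ∈ γ c r, d ∈ ext γ V ν D}
  | atLeast n r D => {c | (n : ℕ∞) ≤ {d | d ∈ γ c r ∧ d ∈ ext γ V ν D}.encard}
  | atMost n r D => {c | {d | d ∈ γ c r ∧ d ∈ ext γ V ν D}.encard ≤ (n : ℕ∞)}

/-- SHOQ concepts as hybrid formulas. -/
def toForm {b : Bool} : SHOQConcept ρ → Form (gradedSig ρ) b 0
  | top => Form.top
  | bot => Form.bot
  | atom p => Form.prop p
  | one i => Form.nom i
  | compl D => Form.neg D.toForm
  | inter D E => Form.and D.toForm E.toForm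
  | union D E => Form.or D.toForm E.toForm
  | ex r D => gradedDia r 0 D.toForm
  | all r D => Form.neg (gradedDia r 0 (Form.neg D.toForm))
  | atLeast 0 _ _ => Form.top
  | atLeast (n + 1) r D => gradedDia r n D.toForm
  | atMost n r D => Form.neg (gradedDia r n D.toForm)

end SHOQConcept

end HybridLogic

open HybridLogic

namespace HybridLogic

open Form

/-! ### Relabelling of formulas, and countability of the language -/

section Formulas

variable {Λ : SimType} {b : Bool}

/-! Graded and Presburger operators are treated together as "counting operators" `∑ₛ coeff s · #(φₛ)
≥ thr` over multigraphs (`IsCountingLogic`). Soundness and completeness are proved once for these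
and then transferred.

Soundness has two nontrivial points. A counting rule is sound because its premise gives a linear
inequality between truth values at every state; multiplying by multiplicities and summing gives the
inequality between the counted totals (`countingRules_sound`). The paste rule is sound because an
operator with threshold `k` depends on each argument only through its weight cut off at `k`, and `k`
states of a nonempty set always realize that much (`exists_min_le_weight_range`).

Completeness is a Henkin construction. Maximal consistent sets are replaced by Boolean truth
assignments that make all theorems true (`IsThVal`); by compactness, whatever all of them make true
is derivable. An underivable formula is refuted by such an assignment in which every true `@_i ♥(φ₁,
…, φₙ)` has paste witnesses (`exists_isPasted_of_not_derivesLoc`). To have infinitely many unused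
nominals even if the assumptions mention all of them, nominals are first doubled.

The states of the canonical model are the nominals modulo `@_i j`, and the multiplicity of `(c, d)`
is the supremum of `m + 1` over all true `@_c ⟨m⟩ d`. The modal case of the truth lemma is two
applications of a counting rule, relative to finitely many facts about named states (`counting_at`):
one infers `♥` from diamonds of nominals (`atN_op_of_le`), the other infers a diamond of a nominal,
stronger than the multiplicities allow, from `♥` and its paste witnesses (`le_of_atN_op`). The model
is countable and all its states are named, so every valuation of nominals is a substitution of
nominals, and pure axioms hold on the frame (`isFrame_canonGraph`).

Over Kripke frames, `¬⟨1⟩_r i` cuts the multigraphs down to multiplicities 0 and 1, so completeness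
is inherited from the graded case. -/

theorem liftLbl_id {n : ℕ} : liftLbl (id : Lbl n → Lbl n) = id := by
  funext l
  rcases l with i | x
  · rfl
  · refine Fin.cases ?_ (fun y => ?_) x <;> rfl

theorem liftLbl_comp {k m n : ℕ} (g : Lbl m → Lbl n) (f : Lbl k → Lbl m) :
    liftLbl (g ∘ f) = liftLbl g ∘ liftLbl f := by
  have key : ∀ l : Lbl m, Sum.map id Fin.succ (g l) = liftLbl g (Sum.map id Fin.succ l) := by
    rintro (i | x) <;> rfl
  funext l
  rcases l with i | x
  · exact key _
  · refine Fin.cases ?_ (fun y => ?_) x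
    · rfl
    · exact key _

theorem liftLbl_sumMap {n : ℕ} (τ : ℕ → ℕ) :
    liftLbl (Sum.map τ (id : Fin n → Fin n)) = Sum.map τ id := by
  funext l
  rcases l with i | x
  · rfl
  · refine Fin.cases ?_ (fun y => ?_) x <;> rfl

namespace Form

theorem map_id' {n : ℕ} (φ : Form Λ b n) : map id φ = φ := by
  induction φ with
  | down hb φ ih => simp only [map, liftLbl_id, ih]
  | _ => simp_all [map]

theorem map_map {k m n : ℕ} (g : Lbl m → Lbl n) (f : Lbl k → Lbl m) (φ : Form Λ b k) :
    map g (map f φ) = map (g ∘ f) φ := by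
  induction φ generalizing m n with
  | down hb φ ih => simp only [map, liftLbl_comp, ih]
  | _ => simp_all [map]

theorem map_congr {m n : ℕ} (f g : Lbl m → Lbl n) (φ : Form Λ b m)
    (h : ∀ i ∈ φ.noms, f (Sum.inl i) = g (Sum.inl i))
    (h' : ∀ x, f (Sum.inr x) = g (Sum.inr x)) : map f φ = map g φ := by
  induction φ generalizing n with
  | bot => rfl
  | prop p => rfl
  | lab l => rcases l with i | x <;> simp_all [map, noms]
  | and φ ψ ih₁ ih₂ =>
    simp only [map]
    rw [ih₁ f g (fun i hi => h i (Or.inl hi)) h', ih₂ f g (fun i hi => h i (Or.inr hi)) h']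
  | neg φ ih => simp only [map]; rw [ih f g h h']
  | op o φ ih =>
    simp only [map]
    congr 1
    funext s
    exact ih s f g (fun i hi => h i (Set.mem_iUnion.2 ⟨s, hi⟩)) h'
  | atL l φ ih =>
    simp only [map]
    rw [ih f g (fun i hi => h i (Or.inr hi)) h']
    rcases l with i | x
    · rw [h i (Or.inl rfl)]
    · rw [h' x]
  | down hb φ ih =>
    simp only [map]
    rw [ih (liftLbl f) (liftLbl g)]
    · intro i hi
      simp only [liftLbl, Sum.elim_inl]
      rw [h i hi]
    · intro x
      refine Fin.cases rfl (fun y => ?_) x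
      simp only [liftLbl, Sum.elim_inr, Fin.cases_succ]
      rw [h' y]

theorem noms_map {n : ℕ} (τ : ℕ → ℕ) (φ : Form Λ b n) :
    (map (Sum.map τ id) φ).noms = τ '' φ.noms := by
  induction φ with
  | bot => simp [map, noms]
  | prop p => simp [map, noms]
  | lab l =>
    rcases l with i | x
    · ext j; simp [map, noms, eq_comm]
    · simp [map, noms]
  | and φ ψ ih₁ ih₂ => simp only [map, noms, ih₁, ih₂, Set.image_union]
  | neg φ ih => simp only [map, noms, ih]
  | op o φ ih => simp only [map, noms, ih, Set.image_iUnion]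
  | atL l φ ih =>
    simp only [map, noms, ih, Set.image_union]
    congr 1
    rcases l with i | x
    · ext j; simp [eq_comm]
    · simp
  | down hb φ ih => simp only [map, noms, liftLbl_sumMap, ih]

theorem noms_finite {n : ℕ} (φ : Form Λ b n) : φ.noms.Finite := by
  induction φ with
  | bot => exact Set.finite_empty
  | prop p => exact Set.finite_empty
  | lab l =>
    refine (Set.finite_singleton (l.elim id (fun _ => 0))).subset ?_
    rintro i rfl; rfl
  | and φ ψ ih₁ ih₂ => exact ih₁.union ih₂
  | neg φ ih => exact ih
  | op o φ ih => exact Set.finite_iUnion ih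
  | atL l φ ih =>
    refine Set.Finite.union ?_ ih
    refine (Set.finite_singleton (l.elim id (fun _ => 0))).subset ?_
    rintro i rfl; rfl
  | down hb φ ih => exact ih

theorem map_imp {m n : ℕ} (f : Lbl m → Lbl n) (φ ψ : Form Λ b m) :
    map f (imp φ ψ) = imp (map f φ) (map f ψ) := rfl

theorem map_bigAnd {m n : ℕ} (f : Lbl m → Lbl n) (l : List (Form Λ b m)) :
    map f (bigAnd l) = bigAnd (l.map (map f)) := by
  induction l with
  | nil => rfl
  | cons φ l ih => simp only [bigAnd, map, ih, List.map_cons]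

theorem map_bigOr {m n : ℕ} (f : Lbl m → Lbl n) (l : List (Form Λ b m)) :
    map f (bigOr l) = bigOr (l.map (map f)) := by
  induction l with
  | nil => rfl
  | cons φ l ih => simp only [bigOr, or, map, ih, List.map_cons]

theorem mem_noms_bigAnd {n : ℕ} {l : List (Form Λ b n)} {i : ℕ} :
    i ∈ (bigAnd l).noms ↔ ∃ φ ∈ l, i ∈ φ.noms := by
  induction l with
  | nil => simp [bigAnd, top, noms]
  | cons φ l ih => simp [bigAnd, noms, ih]

/-- Node labels of formula trees. -/
abbrev NodeLabel (Λ : SimType) : Type :=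
  Unit ⊕ ℕ ⊕ (ℕ ⊕ ℕ) ⊕ Unit ⊕ Unit ⊕ Λ.Op ⊕ (ℕ ⊕ ℕ) ⊕ Unit

/-- Number of children of a node. -/
def nodeArity : NodeLabel Λ → ℕ
  | .inl _ => 0
  | .inr (.inl _) => 0
  | .inr (.inr (.inl _)) => 0
  | .inr (.inr (.inr (.inl _))) => 2
  | .inr (.inr (.inr (.inr (.inl _)))) => 1
  | .inr (.inr (.inr (.inr (.inr (.inl o))))) => Λ.ar o
  | .inr (.inr (.inr (.inr (.inr (.inr (.inl _)))))) => 1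
  | .inr (.inr (.inr (.inr (.inr (.inr (.inr _)))))) => 1

/-- The labelled tree of a formula. -/
def toTree : {n : ℕ} → Form Λ b n → WType (fun a : NodeLabel Λ => Fin (nodeArity a))
  | _, bot => .mk (.inl ()) Fin.elim0
  | _, prop p => .mk (.inr (.inl p)) Fin.elim0
  | _, lab l => .mk (.inr (.inr (.inl (Sum.map id Fin.val l)))) Fin.elim0
  | _, and φ ψ => .mk (.inr (.inr (.inr (.inl ())))) (Fin.cases (toTree φ) (fun _ => toTree ψ))
  | _, neg φ => .mk (.inr (.inr (.inr (.inr (.inl ()))))) (fun _ => toTree φ)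
  | _, op o φ => .mk (.inr (.inr (.inr (.inr (.inr (.inl o)))))) (fun s => toTree (φ s))
  | _, atL l φ => .mk (.inr (.inr (.inr (.inr (.inr (.inr (.inl (Sum.map id Fin.val l))))))))
      (fun _ => toTree φ)
  | _, down _ φ => .mk (.inr (.inr (.inr (.inr (.inr (.inr (.inr ()))))))) (fun _ => toTree φ)

/-- Reduces countability of formulas to that of W-types with finite branching. The tree forgets the
number of enclosing binders, which does no harm as both formulas start at the same `n`. -/
theorem toTree_injective {n : ℕ} (φ ψ : Form Λ b n) (h : toTree φ = toTree ψ) : φ = ψ := by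
  have hl : ∀ {n : ℕ} (l l' : Lbl n), Sum.map id Fin.val l = Sum.map id Fin.val l' → l = l' :=
    fun l l' e => Sum.map_injective.2 ⟨Function.injective_id, Fin.val_injective⟩ e
  have key : ∀ (a a' : NodeLabel Λ) f f',
      (WType.mk a f : WType (fun a : NodeLabel Λ => Fin (nodeArity a))) = WType.mk a' f' →
        a = a' ∧ f ≍ f' := by
    intro a a' f f' h
    cases h
    exact ⟨rfl, HEq.rfl⟩
  induction φ with
  | bot => cases ψ <;> have h := (key _ _ _ _ h).1 <;> simp at h ⊢
  | prop p => cases ψ <;> have h := (key _ _ _ _ h).1 <;> simp at h ⊢; exact h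
  | lab l => cases ψ <;> have h := (key _ _ _ _ h).1 <;> simp at h ⊢; exact hl _ _ h
  | and φ φ' ih₁ ih₂ =>
    cases ψ <;> have h' := (key _ _ _ _ h).1 <;> simp at h' ⊢
    have h := eq_of_heq (key _ _ _ _ h).2
    exact ⟨ih₁ _ (congrFun h (0 : Fin 2)), ih₂ _ (congrFun h (1 : Fin 2))⟩
  | neg φ ih =>
    cases ψ <;> have h' := (key _ _ _ _ h).1 <;> simp at h' ⊢
    exact ih _ (congrFun (eq_of_heq (key _ _ _ _ h).2) (0 : Fin 1))
  | op o φ ih =>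
    cases ψ <;> have h' := (key _ _ _ _ h).1 <;> simp at h'
    subst h'
    have h := eq_of_heq (key _ _ _ _ h).2
    exact congrArg _ (funext fun s => ih s _ (congrFun h s))
  | atL l φ ih =>
    cases ψ <;> have h' := (key _ _ _ _ h).1 <;> simp only [Sum.inr.injEq, Sum.inl.injEq,
      reduceCtorEq] at h'
    obtain rfl := hl _ _ h'
    rw [ih _ (congrFun (eq_of_heq (key _ _ _ _ h).2) (0 : Fin 1))]
  | down hb φ ih =>
    cases ψ <;> have h' := (key _ _ _ _ h).1 <;> simp at h' ⊢
    exact ih _ (congrFun (eq_of_heq (key _ _ _ _ h).2) (0 : Fin 1))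

instance {n : ℕ} [Countable Λ.Op] : Countable (Form Λ b n) := by
  have : Encodable Λ.Op := Encodable.ofCountable _
  exact Function.Injective.countable (f := toTree) toTree_injective

end Form

end Formulas

/-! ### Semantic substitution and coincidence lemmas -/

section Semantics

variable {Λ : SimType} {b : Bool} (S : Sem.{u} Λ) {C : Type u} (γ : C → S.T C) (V : ℕ → Set C)

theorem bindLbl_liftLbl {m n : ℕ} (g : Lbl n → C) (f : Lbl m → Lbl n) (c : C) :
    bindLbl g c ∘ liftLbl f = bindLbl (g ∘ f) c := by
  have key : ∀ l : Lbl n, bindLbl g c (Sum.map id Fin.succ l) = g l := by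
    rintro (i | x) <;> rfl
  funext l
  rcases l with i | x
  · exact key _
  · refine Fin.cases rfl (fun y => ?_) x
    exact key _

theorem sat_map {m n : ℕ} (g : Lbl n → C) (f : Lbl m → Lbl n) (φ : Form Λ b m) (c : C) :
    Sat S γ V g (φ.map f) c ↔ Sat S γ V (g ∘ f) φ c := by
  induction φ generalizing n c with
  | down hb φ ih => simp only [Form.map, Sat, ih, bindLbl_liftLbl]
  | _ => simp_all [Form.map, Sat]

theorem sat_congr {n : ℕ} (g g' : Lbl n → C) (φ : Form Λ b n)
    (h : ∀ i ∈ φ.noms, g (Sum.inl i) = g' (Sum.inl i))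
    (h' : ∀ x, g (Sum.inr x) = g' (Sum.inr x)) (c : C) :
    Sat S γ V g φ c ↔ Sat S γ V g' φ c := by
  induction φ generalizing c with
  | bot => rfl
  | prop p => rfl
  | lab l => rcases l with i | x <;> simp_all [Sat, noms]
  | and φ ψ ih₁ ih₂ =>
    simp only [Sat]
    rw [ih₁ g g' (fun i hi => h i (Or.inl hi)) h', ih₂ g g' (fun i hi => h i (Or.inr hi)) h']
  | neg φ ih => simp only [Sat]; rw [ih g g' h h']
  | op o φ ih =>
    have := fun s d => ih s g g' (fun i hi => h i (Set.mem_iUnion.2 ⟨s, hi⟩)) h' d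
    simp only [Sat, this]
  | atL l φ ih =>
    simp only [Sat]
    rw [ih g g' (fun i hi => h i (Or.inr hi)) h']
    rcases l with i | x
    · rw [h i (Or.inl rfl)]
    · rw [h' x]
  | down hb φ ih =>
    simp only [Sat]
    refine ih _ _ (fun i hi => h i hi) (fun x => ?_) c
    exact Fin.cases rfl (fun y => h' y) x

theorem sat_of_isPure {n : ℕ} (V' : ℕ → Set C) (g : Lbl n → C) (φ : Form Λ b n)
    (h : φ.IsPure) (c : C) : Sat S γ V g φ c ↔ Sat S γ V' g φ c := by
  induction φ generalizing c with
  | bot => rfl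
  | prop p => exact h.elim
  | lab l => rfl
  | and φ ψ ih₁ ih₂ => simp only [Sat, ih₁ g h.1, ih₂ g h.2]
  | neg φ ih => simp only [Sat, ih g h]
  | op o φ ih => simp only [Sat, fun s => ih s g (h s)]
  | atL l φ ih => simp only [Sat, ih g h]
  | down hb φ ih => simp only [Sat, fun g => ih g h]

variable (ν : ℕ → C)

theorem holds_rename (τ : ℕ → ℕ) (φ : Form Λ b 0) (c : C) :
    Holds S γ V ν (φ.rename τ) c ↔ Holds S γ V (ν ∘ τ) φ c := by
  unfold Holds Form.rename
  rw [sat_map]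
  have : Sum.elim ν Fin.elim0 ∘ Sum.map τ id = Sum.elim (ν ∘ τ) (Fin.elim0 : Fin 0 → C) := by
    funext l
    rcases l with i | x
    · rfl
    · exact x.elim0
  rw [this]

theorem holds_congr (ν' : ℕ → C) (φ : Form Λ b 0) (h : ∀ i ∈ φ.noms, ν i = ν' i) (c : C) :
    Holds S γ V ν φ c ↔ Holds S γ V ν' φ c :=
  sat_congr S γ V _ _ φ h (fun x => x.elim0) c

theorem holds_inst (φ : Form Λ b 1) (i : ℕ) (c : C) :
    Holds S γ V ν (φ.inst i) c ↔ Sat S γ V (bindLbl (Sum.elim ν Fin.elim0) (ν i)) φ c := by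
  unfold Holds Form.inst
  rw [sat_map]
  have : (Sum.elim ν Fin.elim0 : Lbl 0 → C) ∘ Sum.elim Sum.inl (fun _ => Sum.inl i) =
      bindLbl (Sum.elim ν Fin.elim0) (ν i) := by
    funext l
    rcases l with i | x
    · rfl
    · refine Fin.cases rfl (fun y => y.elim0) x
  rw [this]

@[simp] theorem holds_and (φ ψ : Form Λ b 0) (c : C) :
    Holds S γ V ν (and φ ψ) c ↔ Holds S γ V ν φ c ∧ Holds S γ V ν ψ c := Iff.rfl

@[simp] theorem holds_nom (i : ℕ) (c : C) :
    Holds S γ V ν (nom i : Form Λ b 0) c ↔ c = ν i := Iff.rfl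

@[simp] theorem holds_atN (i : ℕ) (φ : Form Λ b 0) (c : C) :
    Holds S γ V ν (atN i φ) c ↔ Holds S γ V ν φ (ν i) := Iff.rfl

@[simp] theorem holds_op (o : Λ.Op) (φ : Fin (Λ.ar o) → Form Λ b 0) (c : C) :
    Holds S γ V ν (op o φ) c ↔ γ c ∈ S.lifting o (fun s => {d | Holds S γ V ν (φ s) d}) := Iff.rfl

end Semantics

/-! ### Truth assignments in place of Hilbert-style derivations -/

section Valuations

variable {Λ : SimType} {b : Bool}

/-- Truth assignments to formulas that respect the Boolean connectives. -/
structure IsVal (v : Form Λ b 0 → Prop) : Prop where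
  bot : ¬ v bot
  and : ∀ φ ψ, v (and φ ψ) ↔ v φ ∧ v ψ
  neg : ∀ φ, v (neg φ) ↔ ¬ v φ

namespace IsVal

variable {v : Form Λ b 0 → Prop}

theorem imp (hv : IsVal v) (φ ψ : Form Λ b 0) : v (imp φ ψ) ↔ (v φ → v ψ) := by
  simp only [Form.imp, hv.and, hv.neg]; tauto

theorem or (hv : IsVal v) (φ ψ : Form Λ b 0) : v (or φ ψ) ↔ (v φ ∨ v ψ) := by
  simp only [Form.or, hv.and, hv.neg]; tauto

theorem iff (hv : IsVal v) (φ ψ : Form Λ b 0) : v (iff φ ψ) ↔ (v φ ↔ v ψ) := by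
  simp only [Form.iff, hv.and, hv.imp]; tauto

theorem bigAnd (hv : IsVal v) (l : List (Form Λ b 0)) : v (bigAnd l) ↔ ∀ φ ∈ l, v φ := by
  induction l with
  | nil => simp [Form.bigAnd, top, hv.neg, hv.bot]
  | cons φ l ih => simp [Form.bigAnd, hv.and, ih]

theorem bigOr (hv : IsVal v) (l : List (Form Λ b 0)) : v (bigOr l) ↔ ∃ φ ∈ l, v φ := by
  induction l with
  | nil => simp [Form.bigOr, hv.bot]
  | cons φ l ih => simp [Form.bigOr, hv.or, ih]

open Classical in
theorem subst (hv : IsVal v) {Z : Type} (σ : Z → Form Λ b 0) (p : PForm Z) :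
    v (p.subst σ) ↔ p.eval (fun z => decide (v (σ z))) = true := by
  induction p with
  | bot => simp [PForm.subst, PForm.eval, hv.bot]
  | var z => simp [PForm.subst, PForm.eval]
  | and p q ihp ihq => simp [PForm.subst, PForm.eval, hv.and, ihp, ihq]
  | neg p ih => simp [PForm.subst, PForm.eval, hv.neg, ih]

end IsVal

open Classical in
/-- Compactness of propositional logic. -/
theorem exists_isVal_of_finite (X : Set (Form Λ b 0))
    (h : ∀ l : List (Form Λ b 0), (∀ θ ∈ l, θ ∈ X) →
      ∃ v : Form Λ b 0 → Prop, IsVal v ∧ ∀ θ ∈ l, v θ) :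
    ∃ v : Form Λ b 0 → Prop, IsVal v ∧ ∀ θ ∈ X, v θ := by
  have h' : ∀ F : Finset X, ∃ v : Form Λ b 0 → Prop, IsVal v ∧ ∀ θ : X, θ ∈ F → v θ := by
    intro F
    obtain ⟨v, hv, hF⟩ := h (F.toList.map (↑)) (by simp +contextual)
    exact ⟨v, hv, fun θ hθ => hF θ (List.mem_map.2 ⟨θ, Finset.mem_toList.2 hθ, rfl⟩)⟩
  choose w hw hF using h'
  -- The limit of the assignments `w F` along an ultrafilter finer than `atTop`: each element of `X`
  -- is eventually true, and limits commute with negation because the filter is ultra.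
  let U : Ultrafilter (Finset X) := Ultrafilter.of Filter.atTop
  refine ⟨fun θ => ∀ᶠ F in (U : Filter (Finset X)), w F θ, ⟨?_, ?_, ?_⟩, ?_⟩
  · simp only [(hw _).bot, Filter.eventually_false_iff_eq_bot]
    exact U.neBot.ne
  · intro φ ψ
    simp only [(hw _).and, Filter.eventually_and]
  · intro φ
    simp only [(hw _).neg, Ultrafilter.eventually_not]
  · intro θ hθ
    have hle : (U : Filter (Finset X)) ≤ Filter.atTop := Ultrafilter.of_le _
    refine hle ?_
    filter_upwards [Filter.eventually_ge_atTop ({⟨θ, hθ⟩} : Finset X)] with F hle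
    exact hF F ⟨θ, hθ⟩ (hle (Finset.mem_singleton_self _))

/-- The Boolean skeleton of a formula, with codes of non-Boolean formulas as variables. -/
def reify (e : ∀ n : ℕ, Form Λ b n → ℕ) : {n : ℕ} → Form Λ b n → PForm ℕ
  | _, .bot => .bot
  | _, .and φ ψ => .and (reify e φ) (reify e ψ)
  | _, .neg φ => .neg (reify e φ)
  | n, .prop p => .var (e n (.prop p))
  | n, .lab l => .var (e n (.lab l))
  | n, .op o φ => .var (e n (.op o φ))
  | n, .atL l φ => .var (e n (.atL l φ))
  | n, .down hb φ => .var (e n (.down hb φ))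

theorem subst_reify (e : ∀ n : ℕ, Form Λ b n → ℕ) (σ : ℕ → Form Λ b 0)
    (hσ : ∀ θ : Form Λ b 0, σ (e 0 θ) = θ) : ∀ θ : Form Λ b 0, (reify e θ).subst σ = θ
  | .bot => rfl
  | .and φ ψ => by simp only [reify, PForm.subst, subst_reify e σ hσ φ, subst_reify e σ hσ ψ]
  | .neg φ => by simp only [reify, PForm.subst, subst_reify e σ hσ φ]
  | .prop p => hσ _
  | .lab l => hσ _
  | .op o φ => hσ _
  | .atL l φ => hσ _
  | .down hb φ => hσ _

theorem isVal_eval_reify (e : ∀ n : ℕ, Form Λ b n → ℕ) (v : ℕ → Bool) :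
    IsVal (fun θ : Form Λ b 0 => (reify e θ).eval v = true) :=
  ⟨by simp [reify, PForm.eval], by simp [reify, PForm.eval], by simp [reify, PForm.eval]⟩

theorem exists_coding [Countable Λ.Op] :
    ∃ (e : ∀ n : ℕ, Form Λ b n → ℕ) (σ : ℕ → Form Λ b 0), ∀ θ : Form Λ b 0, σ (e 0 θ) = θ := by
  have h : ∀ n, ∃ f : Form Λ b n → ℕ, Function.Injective f := fun n =>
    Countable.exists_injective_nat _
  choose f hf using h
  have : Nonempty (Form Λ b 0) := ⟨.bot⟩
  exact ⟨f, Function.invFun (f 0), Function.leftInverse_invFun (hf 0)⟩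

variable {L : Axiomatization Λ} {A Φ : Set (Form Λ b 0)}

/-- Truth assignments that moreover make all derivable formulas true. -/
structure IsThVal (L : Axiomatization Λ) (A Φ : Set (Form Λ b 0)) (v : Form Λ b 0 → Prop) : Prop
    extends IsVal v where
  der : ∀ θ, Der L A Φ θ → v θ

namespace IsThVal

variable {v : Form Λ b 0 → Prop}

/-- The formulas true at the state named `i`. -/
theorem atN (hv : IsThVal L A Φ v) (i : ℕ) : IsThVal L A Φ (fun θ => v (atN i θ)) := by
  refine ⟨⟨(hv.neg _).1 (hv.der _ (Der.atBot i)), fun φ ψ => ?_, fun φ => ?_⟩,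
    fun θ hθ => hv.der _ (Der.atGen i θ hθ)⟩
  · exact ((hv.iff _ _).1 (hv.der _ (Der.atAnd i φ ψ))).trans (hv.and _ _)
  · exact ((hv.iff _ _).1 (hv.der _ (Der.atNeg i φ))).symm.trans (hv.neg _)

theorem atN_atN (hv : IsThVal L A Φ v) (i j : ℕ) (φ : Form Λ b 0) :
    v (Form.atN i (Form.atN j φ)) ↔ v (Form.atN j φ) :=
  (hv.iff _ _).1 (hv.der _ (Der.atAgree i j φ))

theorem atN_self (hv : IsThVal L A Φ v) (i : ℕ) : v (Form.atN i (nom i)) :=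
  hv.der _ (Der.atRefl i)

theorem atN_symm (hv : IsThVal L A Φ v) {i j : ℕ} (h : v (Form.atN i (nom j))) :
    v (Form.atN j (nom i)) :=
  ((hv.iff _ _).1 (hv.der _ (Der.atSymm i j))).1 h

theorem atN_trans (hv : IsThVal L A Φ v) {i j : ℕ} {φ : Form Λ b 0}
    (h : v (Form.atN i (nom j))) (h' : v (Form.atN j φ)) : v (Form.atN i φ) :=
  (hv.imp _ _).1 (hv.der _ (Der.atNom i j φ)) ((hv.and _ _).2 ⟨h, h'⟩)

theorem atN_congr (hv : IsThVal L A Φ v) {i j : ℕ} (φ : Form Λ b 0)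
    (h : v (Form.atN i (nom j))) : v (Form.atN i φ) ↔ v (Form.atN j φ) :=
  ⟨hv.atN_trans (hv.atN_symm h), hv.atN_trans h⟩

/-- The introduction axiom gives one direction; applied to `¬φ`, it gives the other, as `@_i`
commutes with negation. -/
theorem atN_of_nom (hv : IsThVal L A Φ v) {i : ℕ} (h : v (nom i)) (φ : Form Λ b 0) :
    v (Form.atN i φ) ↔ v φ := by
  have key : ∀ φ : Form Λ b 0, v φ → v (Form.atN i φ) := fun φ hφ =>
    (hv.imp _ _).1 (hv.der _ (Der.atIntro i φ)) ((hv.and _ _).2 ⟨h, hφ⟩)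
  refine ⟨fun h' => ?_, key φ⟩
  by_contra hφ
  exact ((hv.atN i).neg φ).1 (key _ ((hv.neg φ).2 hφ)) h'

/-- This lets true statements about named states serve as side assumptions inside modal arguments,
although one-step rules take only theorems as premises. -/
theorem atN_op_and (hv : IsThVal L A Φ v) (i j : ℕ) {φ : Form Λ b 0} (h : v (Form.atN j φ))
    (o : Λ.Op) (ψ : Fin (Λ.ar o) → Form Λ b 0) :
    v (Form.atN i (op o ψ)) ↔ v (Form.atN i (op o fun s => Form.and (Form.atN j φ) (ψ s))) := by
  have hi := hv.atN i
  exact (hi.iff _ _).1 ((hi.imp _ _).1 (hi.der _ (Der.mob j φ o ψ)) ((hv.atN_atN i j φ).2 h))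

end IsThVal

/-- Functional completeness of the connectives, by Shannon expansion in the last variable. It
supplies propositional formulas that express numerical inequalities between truth values. -/
theorem PForm.exists_eval_iff (N : ℕ) : ∀ Q : (ℕ → Bool) → Prop,
    (∀ v w : ℕ → Bool, (∀ n < N, v n = w n) → Q v → Q w) →
      ∃ p : PForm ℕ, ∀ v, p.eval v = true ↔ Q v := by
  induction N with
  | zero =>
    intro Q h
    by_cases hQ : Q fun _ => false
    · exact ⟨.neg .bot, fun v => by simpa [PForm.eval] using h _ v (by simp) hQ⟩
    · exact ⟨.bot, fun v => by simpa [PForm.eval] using fun h' => hQ (h v _ (by simp) h')⟩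
  | succ N ih =>
    intro Q h
    have key : ∀ x : Bool, ∃ p : PForm ℕ, ∀ v, p.eval v = true ↔ Q (Function.update v N x) := by
      refine fun x => ih _ fun v w hvw => h _ _ fun n hn => ?_
      rcases Nat.lt_succ_iff_lt_or_eq.1 hn with hn | rfl
      · simp [Function.update_of_ne hn.ne, hvw n hn]
      · simp
    obtain ⟨p, hp⟩ := key true
    obtain ⟨q, hq⟩ := key false
    refine ⟨.neg (.and (.neg (.and (.var N) p)) (.neg (.and (.neg (.var N)) q))), fun v => ?_⟩
    have hu : Function.update v N (v N) = v := Function.update_eq_self N v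
    cases hN : v N
    · rw [hN] at hu
      have := hq v
      rw [hu] at this
      simp [PForm.eval, hN, this]
    · rw [hN] at hu
      have := hp v
      rw [hu] at this
      simp [PForm.eval, hN, this]

/-- A modal operator applied to formulas. -/
abbrev ModalForm (Λ : SimType) (b : Bool) : Type := (o : Λ.Op) × (Fin (Λ.ar o) → Form Λ b 0)

open Classical in
/-- The number of arguments of `x` that `v` makes true, counted with coefficients. -/
noncomputable def trueCount (coeff : ∀ o, Fin (Λ.ar o) → ℕ) (v : Form Λ b 0 → Prop)
    (x : ModalForm Λ b) : ℕ :=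
  ∑ s, coeff x.1 s * (decide (v (x.2 s))).toNat

theorem PForm.subst_bigAnd {Z : Type} (σ : Z → Form Λ b 0) (l : List (PForm Z)) :
    (PForm.bigAnd l).subst σ = Form.bigAnd (l.map (PForm.subst σ)) := by
  induction l with
  | nil => rfl
  | cons φ l ih => simp only [PForm.bigAnd, PForm.subst, ih, List.map_cons, Form.bigAnd]

theorem PForm.subst_bigOr {Z : Type} (σ : Z → Form Λ b 0) (l : List (PForm Z)) :
    (PForm.bigOr l).subst σ = Form.bigOr (l.map (PForm.subst σ)) := by
  induction l with
  | nil => rfl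
  | cons φ l ih =>
    simp only [PForm.bigOr, PForm.or, PForm.subst, ih, List.map_cons, Form.bigOr, Form.or]

variable [Countable Λ.Op]

/-- The Boolean skeleton of `θ` is a tautology, since every assignment to the codes of non-Boolean
formulas induces an `IsVal`. -/
theorem Der.of_isVal (θ : Form Λ b 0) (h : ∀ v, IsVal v → v θ) : Der L A Φ θ := by
  obtain ⟨e, σ, hσ⟩ := exists_coding (Λ := Λ) (b := b)
  rw [← subst_reify e σ hσ θ]
  exact Der.taut _ σ fun v => h _ (isVal_eval_reify e v)

theorem Der.bigAnd (l : List (Form Λ b 0)) (h : ∀ θ ∈ l, Der L A Φ θ) : Der L A Φ (bigAnd l) := by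
  induction l with
  | nil => exact Der.of_isVal _ fun v hv => by simp [hv.bigAnd]
  | cons φ l ih =>
    have h₁ := h φ (by simp)
    have h₂ := ih fun θ hθ => h θ (by simp [hθ])
    refine Der.mp _ _ (Der.mp _ _ (Der.of_isVal _ fun v hv => ?_) h₁) h₂
    simp only [hv.imp, Form.bigAnd, hv.and]
    tauto

/-- Completeness for propositional reasoning over theorems, in compact form. -/
theorem exists_der_neg_bigAnd (X : Set (Form Λ b 0))
    (h : ¬ ∃ v, IsThVal L A Φ v ∧ ∀ θ ∈ X, v θ) :
    ∃ l : List (Form Λ b 0), (∀ θ ∈ l, θ ∈ X) ∧ Der L A Φ (neg (Form.bigAnd l)) := by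
  classical
  by_contra hc
  push Not at hc
  refine h ?_
  suffices hs : _ from
    have ⟨v, hv, hvX⟩ := exists_isVal_of_finite (X ∪ {θ | Der L A Φ θ}) hs
    ⟨v, ⟨hv, fun θ hθ => hvX θ (Or.inr hθ)⟩, fun θ hθ => hvX θ (Or.inl hθ)⟩
  intro l hl
  by_contra hno
  push Not at hno
  -- The members of `l` outside `X` are theorems, so if `l` is unsatisfiable, its part inside `X` is
  -- already refutable.
  refine hc (l.filter (· ∈ X)) (by simp) ?_
  refine Der.mp (Form.bigAnd (l.filter (fun θ => Der L A Φ θ))) _ (Der.of_isVal _ fun v hv => ?_)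
    (Der.bigAnd _ (by simp))
  simp only [hv.imp, hv.neg, hv.bigAnd]
  intro h₁ h₂
  obtain ⟨θ, hθ, hvθ⟩ := hno v hv
  rcases hl θ hθ with h' | h'
  · exact hvθ (h₂ θ (by simp [hθ, h']))
  · exact hvθ (h₁ θ (by simpa [hθ] using h'))

/-- Replaces explicit propositional derivations below: derivability is checked by arguing about one
assignment at a time. -/
theorem Der.of_isThVal (θ : Form Λ b 0) (h : ∀ v, IsThVal L A Φ v → v θ) : Der L A Φ θ := by
  obtain ⟨l, hl, hd⟩ := exists_der_neg_bigAnd (L := L) (A := A) (Φ := Φ) {neg θ} (by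
    rintro ⟨v, hv, hθ⟩
    exact (hv.neg θ).1 (hθ _ rfl) (h v hv))
  refine Der.mp _ _ (Der.of_isVal _ fun v hv => ?_) hd
  simp only [hv.imp, hv.neg, hv.bigAnd]
  intro h'
  by_contra hθ
  refine h' fun φ hφ => ?_
  rw [hl φ hφ, hv.neg]
  exact hθ

/-- The counting rules, with the premise replaced by an inequality between truth values. -/
theorem Der.counting {ρ : Type} {role : Λ.Op → ρ} {coeff : ∀ o, Fin (Λ.ar o) → ℕ} {thr : Λ.Op → ℕ}
    (hL : L.rules = countingRules Λ role coeff thr) (r : ρ) (Γ Δ : List (ℕ × ModalForm Λ b))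
    (hr : ∀ x ∈ Γ ++ Δ, role x.2.1 = r)
    (hle : ∀ v, IsThVal L A Φ v →
      (Γ.map fun x => x.1 * trueCount coeff v x.2).sum ≤
        (Δ.map fun x => x.1 * trueCount coeff v x.2).sum)
    (hlt : (Δ.map fun x => x.1 * thr x.2.1).sum <
      (Γ.map fun x => x.1 * thr x.2.1).sum + (Δ.map fun x => x.1).sum) :
    Der L A Φ (imp (Form.bigAnd (Γ.map fun x => op x.2.1 x.2.2))
      (Form.bigOr (Δ.map fun x => op x.2.1 x.2.2))) := by
  classical
  obtain ⟨e, σ, hσ⟩ := exists_coding (Λ := Λ) (b := b)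
  let enc : ℕ × ModalForm Λ b → ℕ × Λ.Modal := fun x => (x.1, ⟨x.2.1, fun s => e 0 (x.2.2 s)⟩)
  let f : (ℕ → Bool) → ℕ × ModalForm Λ b → ℕ := fun v x =>
    x.1 * ∑ s, coeff x.2.1 s * (v (e 0 (x.2.2 s))).toNat
  let codes : Finset ℕ := ((Γ ++ Δ).toFinset.biUnion fun x =>
    Finset.univ.image fun s => e 0 (x.2.2 s))
  have hf : ∀ v w : ℕ → Bool, (∀ n < codes.sup id + 1, v n = w n) →
      ∀ x ∈ Γ ++ Δ, f v x = f w x := by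
    intro v w hvw x hx
    have : ∀ s, v (e 0 (x.2.2 s)) = w (e 0 (x.2.2 s)) := fun s =>
      hvw _ (Nat.lt_succ_of_le (Finset.le_sup (f := id) (by
        simp only [codes, Finset.mem_biUnion, List.mem_toFinset]
        exact ⟨x, hx, Finset.mem_image_of_mem _ (Finset.mem_univ s)⟩)))
    simp only [f, this]
  -- The premise `p` is chosen to express exactly the inequality required by the rule, so the side
  -- condition is automatic and only the derivability of `p` remains. The bound exceeds every code
  -- that occurs.
  obtain ⟨p, hp⟩ := PForm.exists_eval_iff (codes.sup id + 1)
    (fun v => (Γ.map (f v)).sum ≤ (Δ.map (f v)).sum) (by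
      intro v w hvw h
      have h₁ := List.map_congr_left (fun x hx => hf v w hvw x (List.mem_append_left Δ hx))
      have h₂ := List.map_congr_left (fun x hx => hf v w hvw x (List.mem_append_right Γ hx))
      rw [h₁, h₂] at h
      exact h)
  have hprem : Der L A Φ (p.subst σ) := by
    refine Der.of_isThVal _ fun v hv => ?_
    rw [hv.subst, hp]
    simpa only [f, hσ, trueCount] using hle v hv
  have := Der.rule (L := L) (A := A) (Φ := Φ) ⟨p, PForm.imp
    (PForm.bigAnd ((Γ.map enc).map fun x => PForm.var x.2))
    (PForm.bigOr ((Δ.map enc).map fun x => PForm.var x.2))⟩ σ (by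
      rw [hL]
      refine ⟨r, Γ.map enc, Δ.map enc, ?_, ?_, ?_, rfl⟩
      · rw [← List.map_append]
        intro x hx
        obtain ⟨y, hy, rfl⟩ := List.mem_map.1 hx
        exact hr y hy
      · intro v hv
        simp only [List.map_map]
        exact (hp v).1 hv
      · simp only [List.map_map]
        exact hlt) hprem
  have hconv : ∀ (l : List (ℕ × ModalForm Λ b)),
      ((l.map enc).map fun x => PForm.var x.2).map
        (PForm.subst fun x : Λ.Modal => op x.1 fun s => σ (x.2 s)) =
      l.map fun x => op x.2.1 x.2.2 := by
    intro l
    simp only [List.map_map]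
    refine List.map_congr_left fun x _ => ?_
    simp only [Function.comp_apply, PForm.subst, enc, hσ]
  simp only [PForm.imp, PForm.subst, PForm.subst_bigAnd, PForm.subst_bigOr, hconv] at this
  exact this

end Valuations

/-! ### Weights of sets, and their finite truncations -/

section Weight

variable {X : Type u}

theorem sum_le_weight (B : X → ℕ∞) {Y : Set X} (F : Finset X) (h : (F : Set X) ⊆ Y) :
    ∑ x ∈ F, B x ≤ weight B Y :=
  le_iSup₂ (f := fun (F : Finset X) (_ : (F : Set X) ⊆ Y) => ∑ x ∈ F, B x) F h

theorem natCast_le_weight {B : X → ℕ∞} {Y : Set X} {k : ℕ} (h : (k : ℕ∞) ≤ weight B Y) :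
    ∃ F : Finset X, (F : Set X) ⊆ Y ∧ (k : ℕ∞) ≤ ∑ x ∈ F, B x := by
  cases k with
  | zero => exact ⟨∅, by simp, by simp⟩
  | succ k =>
    have h' : (k : ℕ∞) < weight B Y := by
      refine lt_of_lt_of_le ?_ h
      exact_mod_cast Nat.lt_succ_self k
    simp only [weight, lt_iSup_iff] at h'
    obtain ⟨F, hF, hk⟩ := h'
    exact ⟨F, hF, by exact_mod_cast Order.add_one_le_of_lt hk⟩

@[simp] theorem weight_empty (B : X → ℕ∞) : weight B ∅ = 0 := by
  refine le_antisymm (iSup₂_le fun F hF => ?_) zero_le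
  rw [Set.subset_empty_iff, Finset.coe_eq_empty] at hF
  simp [hF]

theorem weight_singleton (B : X → ℕ∞) (x : X) : weight B {x} = B x := by
  refine le_antisymm (iSup₂_le fun F hF => ?_) ?_
  · rw [← Finset.coe_singleton, Finset.coe_subset] at hF
    exact (Finset.sum_le_sum_of_subset hF).trans (by simp)
  · simpa using sum_le_weight B (Y := {x}) {x} (by simp)

theorem weight_pos {B : X → ℕ∞} {Y : Set X} : 0 < weight B Y ↔ ∃ x ∈ Y, 0 < B x := by
  constructor
  · intro h
    simp only [weight, lt_iSup_iff] at h
    obtain ⟨F, hF, h⟩ := h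
    obtain ⟨x, hx, h⟩ := Finset.exists_ne_zero_of_sum_ne_zero h.ne'
    exact ⟨x, hF hx, pos_iff_ne_zero.2 h⟩
  · rintro ⟨x, hx, h⟩
    refine h.trans_le ?_
    simpa using sum_le_weight B (Y := Y) {x} (by simpa using hx)

/-- Boundedness of counting operators: either one argument with nonzero coefficient reaches `k` by
itself, or all arguments that matter lie below `k` and the cutoff is void. -/
theorem natCast_le_sum_mul_of_min_le {ι : Type*} [Fintype ι] (a : ι → ℕ) (x y : ι → ℕ∞) {k : ℕ}
    (h : (k : ℕ∞) ≤ ∑ s, (a s : ℕ∞) * x s) (hy : ∀ s, min (k : ℕ∞) (x s) ≤ y s) :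
    (k : ℕ∞) ≤ ∑ s, (a s : ℕ∞) * y s := by
  by_cases hs : ∃ s, a s ≠ 0 ∧ (k : ℕ∞) ≤ x s
  · obtain ⟨s, ha, hk⟩ := hs
    have h₁ : (k : ℕ∞) ≤ y s := by simpa [hk] using hy s
    have h₂ : y s ≤ (a s : ℕ∞) * y s :=
      le_mul_of_one_le_left zero_le (by exact_mod_cast Nat.one_le_iff_ne_zero.2 ha)
    exact (h₁.trans h₂).trans
      (Finset.single_le_sum (f := fun s => (a s : ℕ∞) * y s) (fun _ _ => zero_le)
        (Finset.mem_univ s))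
  · push Not at hs
    refine h.trans (Finset.sum_le_sum fun s _ => ?_)
    by_cases ha : a s = 0
    · simp [ha]
    · have := hy s
      rw [min_eq_right (hs s ha).le] at this
      gcongr

/-- The multiplicities of `B`, truncated at `K`. -/
noncomputable def trunc (B : X → ℕ∞) (K : ℕ) (x : X) : ℕ := (min (B x) K).toNat

theorem natCast_trunc (B : X → ℕ∞) (K : ℕ) (x : X) : (trunc B K x : ℕ∞) = min (B x) K :=
  ENat.natCast_toNat (ne_top_of_le_ne_top (ENat.natCast_ne_top K) (min_le_right _ _))

open Classical in
/-- The part of the weight of `Y` contributed by the elements of `F`, truncated at `K`. -/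
noncomputable def partWeight (B : X → ℕ∞) (K : ℕ) (F : Finset X) (Y : Set X) : ℕ :=
  ∑ x ∈ F, trunc B K x * (decide (x ∈ Y)).toNat

theorem partWeight_le (B : X → ℕ∞) (K : ℕ) (F : Finset X) (Y : Set X) :
    (partWeight B K F Y : ℕ∞) ≤ weight B Y := by
  classical
  refine le_trans ?_ (sum_le_weight B (F.filter (· ∈ Y)) (fun x hx => by simpa using
    (Finset.mem_filter.1 hx).2))
  rw [partWeight, Nat.cast_sum, Finset.sum_filter]
  refine Finset.sum_le_sum fun x _ => ?_
  by_cases hx : x ∈ Y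
  · simp [hx, natCast_trunc]
  · simp [hx]

/-- Some finite subset attains the bound; if truncation affects one of its elements, that element
alone contributes `K ≥ k`. The form "eventually in `F`" allows finitely many such requirements to be
met by one `F`. -/
theorem min_le_partWeight (B : X → ℕ∞) (k K : ℕ) (hk : k ≤ K) (Y : Set X) :
    ∀ᶠ F in (Filter.atTop : Filter (Finset X)), min (k : ℕ∞) (weight B Y) ≤ partWeight B K F Y := by
  classical
  obtain ⟨n, hn⟩ : ∃ n : ℕ, (n : ℕ∞) = min (k : ℕ∞) (weight B Y) :=
    ENat.ne_top_iff_exists.1 (ne_top_of_le_ne_top (ENat.natCast_ne_top k) (min_le_left _ _))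
  have hnk : n ≤ k := by exact_mod_cast hn.le.trans (min_le_left _ _)
  obtain ⟨F₀, hF₀, hle⟩ := natCast_le_weight (hn.le.trans (min_le_right _ _))
  filter_upwards [Filter.eventually_ge_atTop F₀] with F hF
  rw [← hn]
  have hmono : partWeight B K F₀ Y ≤ partWeight B K F Y := Finset.sum_le_sum_of_subset hF
  refine le_trans ?_ (Nat.cast_le.2 hmono)
  have heq : (partWeight B K F₀ Y : ℕ∞) = ∑ x ∈ F₀, min (B x) K := by
    rw [partWeight, Nat.cast_sum]
    refine Finset.sum_congr rfl fun x hx => ?_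
    have : x ∈ Y := hF₀ hx
    simp [this, natCast_trunc]
  rw [heq]
  by_cases h : ∃ x ∈ F₀, (K : ℕ∞) ≤ B x
  · obtain ⟨x, hx, hK⟩ := h
    refine le_trans ?_ (Finset.single_le_sum (f := fun x => min (B x) (K : ℕ∞))
      (fun _ _ => zero_le) hx)
    simp only [min_eq_right hK]
    exact_mod_cast hnk.trans hk
  · push Not at h
    refine hle.trans (Finset.sum_le_sum fun x hx => ?_)
    rw [min_eq_left (h x hx).le]

theorem le_sum_partWeight {ι : Type*} [Fintype ι] (B : X → ℕ∞) (a : ι → ℕ) (Y : ι → Set X)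
    {k K : ℕ} (hk : k ≤ K) (h : (k : ℕ∞) ≤ ∑ s, (a s : ℕ∞) * weight B (Y s)) :
    ∀ᶠ F in (Filter.atTop : Filter (Finset X)), k ≤ ∑ s, a s * partWeight B K F (Y s) := by
  filter_upwards [Filter.eventually_all.2 fun s => min_le_partWeight B k K hk (Y s)] with F hF
  exact_mod_cast natCast_le_sum_mul_of_min_le a _ _ h hF

theorem sum_partWeight_le {ι : Type*} [Fintype ι] (B : X → ℕ∞) (a : ι → ℕ) (Y : ι → Set X)
    (K : ℕ) (F : Finset X) :
    ((∑ s, a s * partWeight B K F (Y s) : ℕ) : ℕ∞) ≤ ∑ s, (a s : ℕ∞) * weight B (Y s) := by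
  push_cast
  exact Finset.sum_le_sum fun s _ => by gcongr; exact partWeight_le B K F (Y s)

/-- `k` elements of `Y` suffice to realize the weight of `Y` up to `k`. -/
theorem exists_min_le_weight_range (B : X → ℕ∞) {Y : Set X} (hY : Y.Nonempty) (k : ℕ) :
    ∃ f : Fin k → X, (∀ t, f t ∈ Y) ∧ min (k : ℕ∞) (weight B Y) ≤ weight B (Set.range f) := by
  classical
  obtain ⟨y, hy⟩ := hY
  obtain ⟨n, hn⟩ : ∃ n : ℕ, (n : ℕ∞) = min (k : ℕ∞) (weight B Y) :=
    ENat.ne_top_iff_exists.1 (ne_top_of_le_ne_top (ENat.natCast_ne_top k) (min_le_left _ _))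
  have hnk : (n : ℕ∞) ≤ k := hn.le.trans (min_le_left _ _)
  obtain ⟨F, hF, hle⟩ := natCast_le_weight (hn.le.trans (min_le_right _ _))
  rw [← hn]
  -- After discarding multiplicity 0, every element counts at least 1; if more than `k` remain, any
  -- `k` of them suffice.
  obtain ⟨G, hGF, hGk, hG⟩ : ∃ G ⊆ F, G.card ≤ k ∧ (n : ℕ∞) ≤ ∑ x ∈ G, B x := by
    rw [← Finset.sum_filter_ne_zero] at hle
    by_cases hc : (F.filter (B · ≠ 0)).card ≤ k
    · exact ⟨_, Finset.filter_subset _ _, hc, hle⟩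
    · obtain ⟨G, hG, hGk⟩ := Finset.exists_subset_card_eq (not_le.1 hc).le
      refine ⟨G, hG.trans (Finset.filter_subset _ _), hGk.le, hnk.trans ?_⟩
      calc (k : ℕ∞) = ∑ x ∈ G, 1 := by simp [hGk]
        _ ≤ ∑ x ∈ G, B x := Finset.sum_le_sum fun x hx =>
          Order.one_le_iff_ne_zero.2 (Finset.mem_filter.1 (hG hx)).2
  -- Enumerate `G` and fill the remaining places with `y`; only this needs `Y` to be nonempty.
  refine ⟨fun t => if h : (t : ℕ) < G.card then G.equivFin.symm ⟨t, h⟩ else y, fun t => ?_, ?_⟩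
  · dsimp only
    split_ifs
    · exact hF (hGF (G.equivFin.symm _).2)
    · exact hy
  · refine hG.trans (sum_le_weight B G fun x hx => ?_)
    refine ⟨Fin.castLE hGk (G.equivFin ⟨x, hx⟩), ?_⟩
    simp

end Weight

/-! ### Soundness for counting operators -/

section Counting

variable {ρ : Type} {Λ : SimType} {b : Bool}

/-- Operators that say `∑ₛ coeff ♥ s · #(φₛ) ≥ thr ♥`, interpreted over multigraphs. -/
noncomputable abbrev countingSem (role : Λ.Op → ρ) (coeff : ∀ o, Fin (Λ.ar o) → ℕ)
    (thr : Λ.Op → ℕ) : Sem.{u} Λ where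
  T := fun X => ρ → X → ℕ∞
  lifting := fun o _ Y =>
    {B | (thr o : ℕ∞) ≤ ∑ s, (coeff o s : ℕ∞) * weight (B (role o)) (Y s)}

theorem isVal_holds (S : Sem.{u} Λ) {C : Type u} (γ : C → S.T C) (V : ℕ → Set C) (ν : ℕ → C)
    (c : C) : IsVal fun θ : Form Λ b 0 => Holds S γ V ν θ c :=
  ⟨id, fun _ _ => Iff.rfl, fun _ => Iff.rfl⟩

theorem IsVal.pasteHyp {v : Form Λ b 0 → Prop} (hv : IsVal v) (o : Λ.Op) (k : ℕ)
    (φ : Fin (Λ.ar o) → Form Λ b 0) (i : ℕ) (j : Fin (Λ.ar o) → Fin k → ℕ)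
    (S : Finset (Fin (Λ.ar o))) :
    v (pasteHyp o k φ i j S) ↔ (∀ s ∈ S, ∀ t, v (atN (j s t) (φ s))) ∧
      v (atN i (op o fun s =>
        if s ∈ S then Form.bigOr (List.ofFn fun r => nom (j s r)) else Form.bot)) := by
  unfold HybridLogic.pasteHyp
  rw [hv.and, hv.bigAnd]
  refine and_congr_left fun _ => ⟨fun h s hs t => ?_, fun h θ hθ => ?_⟩
  · refine h _ (List.mem_flatMap.2 ⟨s, List.mem_finRange s, ?_⟩)
    rw [if_pos hs, List.mem_ofFn]
    exact ⟨t, rfl⟩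
  · obtain ⟨s, _, hθ⟩ := List.mem_flatMap.1 hθ
    split_ifs at hθ with hs
    · obtain ⟨t, rfl⟩ := List.mem_ofFn.1 hθ
      exact h s hs t
    · simp at hθ

/-- Exchanges summation over operators with summation over states, so that an inequality between
totals follows from one at each state. -/
theorem sum_mul_sum_comm {α X : Type*} {ι : α → Type*} [∀ x, Fintype (ι x)] (l : List (ℕ × α))
    (a : ∀ x, ι x → ℕ) (F : Finset X) (m : X → ℕ) (t : ∀ x, ι x → X → ℕ) :
    (l.map fun x => x.1 * ∑ s, a x.2 s * ∑ d ∈ F, m d * t x.2 s d).sum =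
      ∑ d ∈ F, m d * (l.map fun x => x.1 * ∑ s, a x.2 s * t x.2 s d).sum := by
  induction l with
  | nil => simp
  | cons x l ih =>
    simp only [List.map_cons, List.sum_cons, ih, mul_add, Finset.sum_add_distrib]
    congr 1
    simp only [Finset.mul_sum]
    rw [Finset.sum_comm]
    exact Finset.sum_congr rfl fun d _ => Finset.sum_congr rfl fun s _ => by ring

variable {role : Λ.Op → ρ} {coeff : ∀ o, Fin (Λ.ar o) → ℕ} {thr : Λ.Op → ℕ}

/-- If the conclusion failed, the `Γ`-total would be at least `∑ wₓ kₓ`, while the `Δ`-total, with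
one added to each count, would be at most its own `∑ wₓ kₓ`. The pointwise inequality from the
premise, summed with multiplicities, then contradicts the side condition. Restricting to a finite
`F` and truncating keeps all totals in `ℕ`. -/
theorem countingRules_sound {R : OneStepRule Λ} (hR : R ∈ countingRules Λ role coeff thr)
    {C : Type u} (γ : C → ρ → C → ℕ∞) (V : ℕ → Set C) (ν : ℕ → C) (σ : ℕ → Form Λ b 0)
    (h : ∀ d, Holds (countingSem role coeff thr) γ V ν (R.prem.subst σ) d) (c : C) :
    Holds (countingSem role coeff thr) γ V ν
      (R.concl.subst fun x => op x.1 fun s => σ (x.2 s)) c := by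
  classical
  obtain ⟨r, Γ, Δ, hr, hle, hlt, hc⟩ := hR
  have hv := fun d => isVal_holds (b := b) (countingSem role coeff thr) γ V ν d
  have hle' := fun d => hle _ (((hv d).subst σ _).1 (h d))
  rw [hc]
  simp only [PForm.imp, PForm.subst, PForm.subst_bigAnd, PForm.subst_bigOr]
  refine ((hv c).imp _ _).2 fun hΓ => ?_
  by_contra hΔ
  rw [(hv c).bigAnd] at hΓ
  rw [(hv c).bigOr] at hΔ
  push Not at hΔ
  simp only [List.map_map, List.mem_map, Function.comp_apply, PForm.subst,
    forall_exists_index, and_imp, forall_apply_eq_imp_iff₂] at hΓ hΔ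
  let Y : ℕ → Set C := fun z => {d | Holds (countingSem role coeff thr) γ V ν (σ z) d}
  -- Any cutoff above all thresholds in `Γ` works.
  let K : ℕ := (Γ.map fun x => thr x.2.1).sum
  have hev : ∀ᶠ F in (Filter.atTop : Filter (Finset C)), ∀ x ∈ {x | x ∈ Γ},
      thr x.2.1 ≤ ∑ s, coeff x.2.1 s * partWeight (γ c r) K F (Y (x.2.2 s)) := by
    refine (Filter.eventually_all_finite Γ.finite_toSet).2 fun x hx => ?_
    refine le_sum_partWeight _ _ _ (List.single_le_sum (by simp) _ (List.mem_map_of_mem hx)) ?_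
    have := hΓ x hx
    rw [← hr x (List.mem_append_left _ hx)]
    exact this
  obtain ⟨F, hF⟩ := hev.exists
  have h₁ : (Γ.map fun x => x.1 * thr x.2.1).sum ≤
      (Γ.map fun x => x.1 * ∑ s, coeff x.2.1 s * partWeight (γ c r) K F (Y (x.2.2 s))).sum :=
    List.sum_le_sum fun x hx => Nat.mul_le_mul_left _ (hF x hx)
  have h₂ : (Δ.map fun x => x.1 *
      (∑ s, coeff x.2.1 s * partWeight (γ c r) K F (Y (x.2.2 s)) + 1)).sum ≤
      (Δ.map fun x => x.1 * thr x.2.1).sum := by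
    refine List.sum_le_sum fun x hx => Nat.mul_le_mul_left _ ?_
    have hn := hΔ x hx
    have h' : ¬ (thr x.2.1 : ℕ∞) ≤ ∑ s, (coeff x.2.1 s : ℕ∞) * weight (γ c r) (Y (x.2.2 s)) := by
      rw [← hr x (List.mem_append_right _ hx)]
      exact hn
    exact_mod_cast (sum_partWeight_le (γ c r) (coeff x.2.1) _ K F).trans_lt (not_le.1 h')
  have h₃ : (Γ.map fun x => x.1 * ∑ s, coeff x.2.1 s * partWeight (γ c r) K F (Y (x.2.2 s))).sum ≤
      (Δ.map fun x => x.1 * ∑ s, coeff x.2.1 s * partWeight (γ c r) K F (Y (x.2.2 s))).sum := by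
    unfold partWeight
    rw [sum_mul_sum_comm Γ (fun x : Λ.Modal => coeff x.1) F (trunc (γ c r) K)
        (fun x s d => (decide (d ∈ Y (x.2 s))).toNat),
      sum_mul_sum_comm Δ (fun x : Λ.Modal => coeff x.1) F (trunc (γ c r) K)
        (fun x s d => (decide (d ∈ Y (x.2 s))).toNat)]
    exact Finset.sum_le_sum fun d _ => Nat.mul_le_mul_left _ (hle' d)
  simp only [mul_add, mul_one, List.sum_map_add] at h₂
  change _ < _ + (Δ.map Prod.fst).sum at hlt
  omega

/-- Soundness of the Hilbert system for pure extensions. -/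
theorem Der.sound (har : ∀ o, 0 < Λ.ar o) {L : Axiomatization Λ}
    (hL : L.rules ⊆ countingRules Λ role coeff thr) (hb : L.bound = thr)
    {A Φ : Set (Form Λ b 0)} {φ : Form Λ b 0} (h : Der L A Φ φ) {C : Type u}
    (γ : C → (countingSem role coeff thr).T C) (hA : IsFrame (countingSem role coeff thr) γ A)
    (V : ℕ → Set C) (ν : ℕ → C) (hΦ : ∀ χ ∈ Φ, ∀ d, Holds (countingSem role coeff thr) γ V ν χ d) (c : C) :
    Holds (countingSem role coeff thr) γ V ν φ c := by
  classical
  have hv := fun ν d => isVal_holds (b := b) (countingSem role coeff thr) γ V ν d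
  induction h generalizing ν c with
  | hyp φ hφ => exact hΦ φ hφ c
  | taut φ σ hφ => exact ((hv ν c).subst σ φ).2 (hφ _)
  | atIntro i φ =>
    rw [(hv ν c).imp, (hv ν c).and]
    rintro ⟨rfl, h⟩
    exact h
  | mob i φ o ψ =>
    rw [(hv ν c).imp, (hv ν c).iff]
    intro h
    have h' : Holds (countingSem role coeff thr) γ V ν φ (ν i) := h
    simp [h']
  | atBot i => exact id
  | atNeg i φ => rw [(hv ν c).iff]; rfl
  | atAnd i φ ψ => rw [(hv ν c).iff]; rfl
  | atRefl i => exact rfl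
  | atSymm i j => rw [(hv ν c).iff]; exact eq_comm
  | atNom i j φ =>
    rw [(hv ν c).imp, (hv ν c).and]
    rintro ⟨h, h'⟩
    have : ν i = ν j := h
    rw [holds_atN] at h' ⊢
    rwa [this]
  | atAgree i j φ => rw [(hv ν c).iff]; rfl
  | pureAx α τ hα =>
    exact (holds_rename (countingSem role coeff thr) γ V ν τ α c).2 (hA V (ν ∘ τ) α hα c)
  | da hb' i φ =>
    rw [holds_atN, (hv ν (ν i)).iff, holds_inst]
    rfl
  | mp φ ψ _ _ ih₁ ih₂ => exact ((hv ν c).imp _ _).1 (ih₁ ν hΦ c) (ih₂ ν hΦ c)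
  | atGen i φ _ ih => exact ih ν hΦ (ν i)
  | rule R σ hR _ ih => exact countingRules_sound (hL hR) γ V ν σ (ih ν hΦ) c
  | name i φ hi hi' _ ih =>
    -- The fresh nominal is reinterpreted as the state `c` under consideration.
    have key : ∀ χ : Form Λ b 0, i ∉ χ.noms → ∀ d, Holds (countingSem role coeff thr) γ V ν χ d ↔
        Holds (countingSem role coeff thr) γ V (Function.update ν i c) χ d := fun χ hχ d =>
      holds_congr _ γ V ν _ χ (fun x hx =>
        (Function.update_of_ne (fun e : x = i => hχ (e ▸ hx)) _ _).symm) d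
    rw [key φ hi]
    refine ((hv _ c).imp _ _).1 (ih _ (fun χ hχ d => (key χ (hi' χ hχ) d).1 (hΦ χ hχ d)) c) ?_
    simp
  | paste o φ i ψ j hj hfr _ ih =>
    rw [(hv ν c).imp]
    intro hop
    by_contra hψ
    let Y : Fin (Λ.ar o) → Set C := fun s =>
      {d | Holds (countingSem role coeff thr) γ V ν (φ s) d}
    let B : C → ℕ∞ := γ (ν i) (role o)
    have hbo : L.bound o = thr o := congrFun hb o
    have hle : (L.bound o : ℕ∞) ≤ ∑ s, (coeff o s : ℕ∞) * weight B (Y s) := by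
      rw [hbo]
      exact hop
    have hf : ∀ s, ∃ f : Fin (L.bound o) → C, (Y s).Nonempty → (∀ t, f t ∈ Y s) ∧
        min (L.bound o : ℕ∞) (weight B (Y s)) ≤ weight B (Set.range f) := by
      intro s
      by_cases hs : (Y s).Nonempty
      · obtain ⟨f, hf⟩ := exists_min_le_weight_range B hs (L.bound o)
        exact ⟨f, fun _ => hf⟩
      · exact ⟨fun _ => c, fun h => absurd h hs⟩
    choose f hf using hf
    -- With bound 0 the operator may hold although all `Y s` are empty. No witnesses are needed
    -- then, so all arguments can be put into `S` to make it nonempty.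
    let S : Finset (Fin (Λ.ar o)) := Finset.univ.filter fun s => L.bound o = 0 ∨ (Y s).Nonempty
    have hS : S.Nonempty := by
      by_cases h0 : L.bound o = 0
      · exact ⟨⟨0, har o⟩, by simp [S, h0]⟩
      · by_contra hS
        have hS' : ∀ s, Y s = ∅ := fun s => by
          by_contra hs
          exact hS ⟨s, by simp [S, Set.nonempty_iff_ne_empty.2 hs]⟩
        simp only [hS', weight_empty, mul_zero, Finset.sum_const_zero, nonpos_iff_eq_zero,
          Nat.cast_eq_zero] at hle
        exact h0 hle
    have hinj : Function.Injective fun p : Fin (Λ.ar o) × Fin (L.bound o) => j p.1 p.2 := by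
      rintro ⟨s, t⟩ ⟨s', t'⟩ h
      obtain ⟨rfl, rfl⟩ := hj s s' t t' h
      rfl
    -- The fresh nominals name the chosen witnesses; this is possible as they are pairwise distinct.
    let ν' : ℕ → C := Function.extend (fun p : Fin (Λ.ar o) × Fin (L.bound o) => j p.1 p.2)
      (fun p => f p.1 p.2) ν
    have hν' : ∀ s t, ν' (j s t) = f s t := fun s t => hinj.extend_apply _ _ (s, t)
    have hνne : ∀ x, (∀ s t, j s t ≠ x) → ν x = ν' x := fun x hx =>
      (Function.extend_apply' _ _ _ (by rintro ⟨⟨s, t⟩, h⟩; exact hx s t h)).symm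
    have key : ∀ χ : Form Λ b 0, (∀ s t, j s t ∉ χ.noms) → ∀ d,
        Holds (countingSem role coeff thr) γ V ν χ d ↔
          Holds (countingSem role coeff thr) γ V ν' χ d := fun χ hχ d =>
      holds_congr _ γ V ν _ χ (fun x hx => hνne x fun s t e => hχ s t (e ▸ hx)) d
    have hi : ν i = ν' i := hνne i fun s t => (hfr s t).1
    have hφ : ∀ s' d, Holds (countingSem role coeff thr) γ V ν (φ s') d ↔
        Holds (countingSem role coeff thr) γ V ν' (φ s') d := fun s' =>
      key _ fun s t => (hfr s t).2.1 s'
    refine hψ ((key ψ (fun s t => (hfr s t).2.2.1) c).2 (((hv ν' c).imp _ _).1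
      (ih S hS ν' (fun χ hχ d => (key χ (fun s t => (hfr s t).2.2.2 χ hχ) d).1 (hΦ χ hχ d)) c)
      (((hv ν' c).pasteHyp _ _ _ _ _ _).2 ⟨fun s hs t => ?_, ?_⟩)))
    · rw [holds_atN, hν', ← hφ]
      rcases (Finset.mem_filter.1 hs).2 with h0 | hs'
      · exact absurd t.2 (by omega)
      · exact (hf s hs').1 t
    · rw [holds_atN, ← hi, holds_op]
      show (thr o : ℕ∞) ≤ ∑ s, (coeff o s : ℕ∞) * weight B _
      rw [← hbo]
      refine natCast_le_sum_mul_of_min_le _ _ _ hle fun s => ?_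
      by_cases hs : s ∈ S
      · rcases (Finset.mem_filter.1 hs).2 with h0 | hs'
        · simp [h0]
        · refine (hf s hs').2.trans (le_of_eq ?_)
          congr 1
          ext d
          simp only [if_pos hs, Set.mem_range, Set.mem_ofPred_eq]
          rw [(hv ν' d).bigOr]
          constructor
          · rintro ⟨t, rfl⟩
            exact ⟨_, List.mem_ofFn.2 ⟨t, rfl⟩, (hν' s t).symm⟩
          · rintro ⟨θ, hθ, h⟩
            obtain ⟨t, rfl⟩ := List.mem_ofFn.1 hθ
            exact ⟨t, (hν' s t).symm.trans h.symm⟩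
      · have : Y s = ∅ := by
          by_contra hne
          exact hs (by simp [S, Set.nonempty_iff_ne_empty.2 hne])
        simp [this]

end Counting

/-! ### Renaming of nominals in derivations, and finiteness of derivations -/

section Renaming

variable {Λ : SimType} {b : Bool} {L : Axiomatization Λ} {A : Set (Form Λ b 0)}

theorem PForm.rename_subst (τ : ℕ → ℕ) {Z : Type} (σ : Z → Form Λ b 0) (p : PForm Z) :
    (p.subst σ).rename τ = p.subst fun z => (σ z).rename τ := by
  induction p with
  | bot => rfl
  | var z => rfl
  | and p q ihp ihq =>
    simp only [Form.rename] at ihp ihq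
    simp only [PForm.subst, Form.rename, Form.map, ihp, ihq]
  | neg p ih =>
    simp only [Form.rename] at ih
    simp only [PForm.subst, Form.rename, Form.map, ih]

theorem Form.rename_inst (τ : ℕ → ℕ) (φ : Form Λ b 1) (i : ℕ) :
    (φ.inst i).rename τ = (φ.map (Sum.map τ id)).inst (τ i) := by
  unfold Form.rename Form.inst
  rw [Form.map_map, Form.map_map]
  congr 1
  funext l
  rcases l with x | x <;> rfl

theorem Form.rename_rename (τ τ' : ℕ → ℕ) (φ : Form Λ b 0) :
    (φ.rename τ').rename τ = φ.rename (τ ∘ τ') := by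
  unfold Form.rename
  rw [Form.map_map]
  congr 1
  funext l
  rcases l with x | x <;> rfl

theorem Form.rename_eq_self (τ : ℕ → ℕ) (φ : Form Λ b 0) (h : ∀ i ∈ φ.noms, τ i = i) :
    φ.rename τ = φ := by
  unfold Form.rename
  conv_rhs => rw [← Form.map_id' φ]
  exact Form.map_congr _ _ φ (fun i hi => congrArg Sum.inl (h i hi)) (fun x => x.elim0)

theorem Form.noms_rename (τ : ℕ → ℕ) (φ : Form Λ b 0) : (φ.rename τ).noms = τ '' φ.noms :=
  Form.noms_map τ φ

theorem Form.mem_noms_rename {τ : ℕ → ℕ} (hτ : Function.Injective τ) (φ : Form Λ b 0) (i : ℕ) :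
    τ i ∈ (φ.rename τ).noms ↔ i ∈ φ.noms := by
  rw [Form.noms_rename, hτ.mem_set_image]

theorem rename_pasteHyp (τ : ℕ → ℕ) (o : Λ.Op) (k : ℕ) (φ : Fin (Λ.ar o) → Form Λ b 0) (i : ℕ)
    (j : Fin (Λ.ar o) → Fin k → ℕ) (S : Finset (Fin (Λ.ar o))) :
    (pasteHyp o k φ i j S).rename τ =
      pasteHyp o k (fun s => (φ s).rename τ) (τ i) (fun s t => τ (j s t)) S := by
  simp only [pasteHyp, Form.rename, Form.map, Form.map_bigAnd, atN, List.map_flatMap]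
  congr 1
  · congr 1
    congr 1
    funext s
    split_ifs
    · simp only [List.map_ofFn]
      rfl
    · rfl
  · congr 2
    funext s
    split_ifs
    · rw [Form.map_bigOr, List.map_ofFn]
      rfl
    · rfl

/-- Injectivity keeps fresh nominals fresh and distinct ones distinct. The set `A` need not be
renamed, being closed under substitution inside the system. -/
theorem Der.rename {Φ : Set (Form Λ b 0)} {θ : Form Λ b 0} (h : Der L A Φ θ) {τ : ℕ → ℕ}
    (hτ : Function.Injective τ) : Der L A (Form.rename τ '' Φ) (θ.rename τ) := by
  induction h with
  | hyp φ hφ => exact Der.hyp _ ⟨φ, hφ, rfl⟩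
  | taut φ σ hφ =>
    rw [PForm.rename_subst]
    exact Der.taut φ _ hφ
  | atIntro i φ => exact Der.atIntro _ _
  | mob i φ o ψ => exact Der.mob _ _ _ _
  | atBot i => exact Der.atBot _
  | atNeg i φ => exact Der.atNeg _ _
  | atAnd i φ ψ => exact Der.atAnd _ _ _
  | atRefl i => exact Der.atRefl _
  | atSymm i j => exact Der.atSymm _ _
  | atNom i j φ => exact Der.atNom _ _ _
  | atAgree i j φ => exact Der.atAgree _ _ _
  | pureAx α τ' hα =>
    rw [Form.rename_rename]
    exact Der.pureAx _ _ hα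
  | da hb i φ =>
    have := Der.da (L := L) (A := A) (Φ := Form.rename τ '' Φ) hb (τ i) (φ.map (Sum.map τ id))
    rw [← Form.rename_inst] at this
    have heq : (atN i (iff (down hb φ) (φ.inst i))).rename τ =
        atN (τ i) (iff (down hb (φ.map (liftLbl (Sum.map τ id)))) ((φ.inst i).rename τ)) := rfl
    rw [heq, liftLbl_sumMap]
    exact this
  | mp φ ψ _ _ ih₁ ih₂ => exact Der.mp _ _ ih₁ ih₂
  | atGen i φ _ ih => exact Der.atGen _ _ ih
  | rule R σ hR _ ih =>
    rw [PForm.rename_subst] at ih ⊢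
    exact Der.rule R (fun z => (σ z).rename τ) hR ih
  | name i φ hi hi' _ ih =>
    refine Der.name (τ i) _ ((Form.mem_noms_rename hτ φ i).not.2 hi) ?_ ih
    rintro _ ⟨χ, hχ, rfl⟩
    exact (Form.mem_noms_rename hτ χ i).not.2 (hi' χ hχ)
  | paste o φ i ψ j hj hfr _ ih =>
    refine Der.paste o (fun s => (φ s).rename τ) (τ i) (ψ.rename τ) (fun s t => τ (j s t))
      (fun s s' t t' h => hj s s' t t' (hτ h)) (fun s t => ⟨?_, fun s' => ?_, ?_, ?_⟩)
      fun S hS => ?_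
    · exact hτ.ne (hfr s t).1
    · exact (Form.mem_noms_rename hτ _ _).not.2 ((hfr s t).2.1 s')
    · exact (Form.mem_noms_rename hτ _ _).not.2 (hfr s t).2.2.1
    · rintro _ ⟨χ, hχ, rfl⟩
      exact (Form.mem_noms_rename hτ χ _).not.2 ((hfr s t).2.2.2 χ hχ)
    · rw [← rename_pasteHyp]
      exact ih S hS

/-- A derivation uses only finitely many global assumptions. -/
theorem Der.exists_finite {Φ : Set (Form Λ b 0)} {θ : Form Λ b 0} (h : Der L A Φ θ) :
    ∃ Φ₀ ⊆ Φ, Φ₀.Finite ∧ ∀ Φ', Φ₀ ⊆ Φ' → Φ' ⊆ Φ → Der L A Φ' θ := by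
  induction h with
  | hyp φ hφ =>
    exact ⟨{φ}, by simpa using hφ, Set.finite_singleton φ, fun Φ' h _ => Der.hyp φ (h rfl)⟩
  | taut φ σ hφ => exact ⟨∅, by simp, Set.finite_empty, fun _ _ _ => Der.taut φ σ hφ⟩
  | atIntro i φ => exact ⟨∅, by simp, Set.finite_empty, fun _ _ _ => Der.atIntro i φ⟩
  | mob i φ o ψ => exact ⟨∅, by simp, Set.finite_empty, fun _ _ _ => Der.mob i φ o ψ⟩
  | atBot i => exact ⟨∅, by simp, Set.finite_empty, fun _ _ _ => Der.atBot i⟩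
  | atNeg i φ => exact ⟨∅, by simp, Set.finite_empty, fun _ _ _ => Der.atNeg i φ⟩
  | atAnd i φ ψ => exact ⟨∅, by simp, Set.finite_empty, fun _ _ _ => Der.atAnd i φ ψ⟩
  | atRefl i => exact ⟨∅, by simp, Set.finite_empty, fun _ _ _ => Der.atRefl i⟩
  | atSymm i j => exact ⟨∅, by simp, Set.finite_empty, fun _ _ _ => Der.atSymm i j⟩
  | atNom i j φ => exact ⟨∅, by simp, Set.finite_empty, fun _ _ _ => Der.atNom i j φ⟩
  | atAgree i j φ => exact ⟨∅, by simp, Set.finite_empty, fun _ _ _ => Der.atAgree i j φ⟩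
  | pureAx α τ hα => exact ⟨∅, by simp, Set.finite_empty, fun _ _ _ => Der.pureAx α τ hα⟩
  | da hb i φ => exact ⟨∅, by simp, Set.finite_empty, fun _ _ _ => Der.da hb i φ⟩
  | mp φ ψ _ _ ih₁ ih₂ =>
    -- Subderivations must be brought to a common set of assumptions. Quantifying over all
    -- intermediate `Φ'` allows this: freshness survives enlargement only as long as `Φ'` stays
    -- inside `Φ`.
    obtain ⟨Φ₁, h₁, hf₁, hd₁⟩ := ih₁
    obtain ⟨Φ₂, h₂, hf₂, hd₂⟩ := ih₂
    exact ⟨Φ₁ ∪ Φ₂, Set.union_subset h₁ h₂, hf₁.union hf₂, fun Φ' h h' =>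
      Der.mp _ _ (hd₁ Φ' (Set.subset_union_left.trans h) h')
        (hd₂ Φ' (Set.subset_union_right.trans h) h')⟩
  | atGen i φ _ ih =>
    obtain ⟨Φ₁, h₁, hf₁, hd₁⟩ := ih
    exact ⟨Φ₁, h₁, hf₁, fun Φ' h h' => Der.atGen i φ (hd₁ Φ' h h')⟩
  | rule R σ hR _ ih =>
    obtain ⟨Φ₁, h₁, hf₁, hd₁⟩ := ih
    exact ⟨Φ₁, h₁, hf₁, fun Φ' h h' => Der.rule R σ hR (hd₁ Φ' h h')⟩
  | name i φ hi hi' _ ih =>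
    obtain ⟨Φ₁, h₁, hf₁, hd₁⟩ := ih
    exact ⟨Φ₁, h₁, hf₁, fun Φ' h h' =>
      Der.name i φ hi (fun χ hχ => hi' χ (h' hχ)) (hd₁ Φ' h h')⟩
  | paste o φ i ψ j hj hfr _ ih =>
    choose Φ₁ h₁ hf₁ hd₁ using ih
    refine ⟨⋃ S, ⋃ hS, Φ₁ S hS, Set.iUnion₂_subset h₁,
      Set.finite_iUnion fun S => Set.finite_iUnion fun hS => hf₁ S hS, fun Φ' h h' => ?_⟩
    refine Der.paste o φ i ψ j hj (fun s t => ?_) fun S hS => ?_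
    · exact ⟨(hfr s t).1, (hfr s t).2.1, (hfr s t).2.2.1,
        fun χ hχ => (hfr s t).2.2.2 χ (h' hχ)⟩
    · exact hd₁ S hS Φ' ((Set.subset_iUnion₂ (s := fun S hS => Φ₁ S hS) S hS).trans h) h'

end Renaming

/-! ### Lindenbaum construction with paste witnesses -/

section Lindenbaum

variable {Λ : SimType} {b : Bool} {L : Axiomatization Λ} {A Φ : Set (Form Λ b 0)}

/-- The nominals that occur neither in `Φ` nor in `X`. -/
def freshNoms (Φ X : Set (Form Λ b 0)) : Set ℕ :=
  {x | (∀ χ ∈ Φ, x ∉ χ.noms) ∧ ∀ χ ∈ X, x ∉ χ.noms}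

theorem freshNoms_insert_infinite {X : Set (Form Λ b 0)} (h : (freshNoms Φ X).Infinite)
    (θ : Form Λ b 0) : (freshNoms Φ (insert θ X)).Infinite := by
  refine (h.sdiff θ.noms_finite).mono ?_
  rintro x ⟨⟨h₁, h₂⟩, h₃⟩
  refine ⟨h₁, fun χ hχ => ?_⟩
  rcases Set.mem_insert_iff.1 hχ with rfl | hχ
  · exact h₃
  · exact h₂ χ hχ

variable (L A Φ) in
/-- Sets of formulas that some truth assignment compatible with the theorems makes true. -/
def IsConsistent (X : Set (Form Λ b 0)) : Prop := ∃ v, IsThVal L A Φ v ∧ ∀ θ ∈ X, v θ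

variable [Countable Λ.Op]

/-- If fresh witnesses failed for every `S`, each failure would use finitely many elements of `X`.
The paste rule, with the negated conjunction of all of these as conclusion, would then refute `X`.
-/
theorem IsConsistent.exists_paste {X : Set (Form Λ b 0)} (h : IsConsistent L A Φ X)
    (hfr : (freshNoms Φ X).Infinite) {i : ℕ} {o : Λ.Op} {φ : Fin (Λ.ar o) → Form Λ b 0}
    (hX : atN i (op o φ) ∈ X) :
    ∃ j S, S.Nonempty ∧ IsConsistent L A Φ (insert (pasteHyp o (L.bound o) φ i j S) X) := by
  classical
  by_contra hcon
  push Not at hcon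
  let e := hfr.natEmbedding
  let j : Fin (Λ.ar o) → Fin (L.bound o) → ℕ := fun s t => e (Nat.pair s t)
  have hd : ∀ S : Finset (Fin (Λ.ar o)), ∃ l : List (Form Λ b 0), (∀ θ ∈ l, θ ∈ X) ∧
      (S.Nonempty → Der L A Φ (imp (pasteHyp o (L.bound o) φ i j S) (neg (bigAnd l)))) := by
    intro S
    by_cases hS : S.Nonempty
    · obtain ⟨l, hl, hd⟩ := exists_der_neg_bigAnd _ (hcon j S hS)
      refine ⟨l.filter (· ∈ X), by simp, fun _ => Der.of_isThVal _ fun v hv => ?_⟩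
      have := hv.der _ hd
      simp only [hv.imp, hv.neg, hv.bigAnd] at this ⊢
      intro hp hX
      refine this fun θ hθ => ?_
      rcases Set.mem_insert_iff.1 (hl θ hθ) with rfl | h'
      · exact hp
      · exact hX θ (by simp [hθ, h'])
    · exact ⟨[], by simp, fun h => absurd h hS⟩
  choose l hl hd using hd
  -- All premises of the paste rule share one conclusion, so the lists for the different `S` are
  -- merged.
  let M : List (Form Λ b 0) := (Finset.univ : Finset (Finset (Fin (Λ.ar o)))).toList.flatMap l
  have hM : ∀ S, ∀ θ ∈ l S, θ ∈ M := fun S θ hθ => List.mem_flatMap.2 ⟨S, by simp, hθ⟩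
  have hMX : ∀ θ ∈ M, θ ∈ X := fun θ hθ => by
    obtain ⟨S, _, hθ⟩ := List.mem_flatMap.1 hθ
    exact hl S θ hθ
  have hj : ∀ s t, j s t ∈ freshNoms Φ X := fun s t => (e (Nat.pair s t)).2
  have hder : Der L A Φ (imp (atN i (op o φ)) (neg (bigAnd M))) := by
    refine Der.paste o φ i _ j ?_ (fun s t => ⟨?_, fun s' h' => ?_, fun h' => ?_, (hj s t).1⟩) ?_
    · intro s s' t t' h
      have := Nat.pair_eq_pair.1 (e.injective (Subtype.ext h))
      exact ⟨Fin.ext this.1, Fin.ext this.2⟩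
    · exact fun h' => (hj s t).2 _ hX (Or.inl (congrArg Sum.inl h'.symm))
    · exact (hj s t).2 _ hX (Or.inr (Set.mem_iUnion.2 ⟨s', h'⟩))
    · obtain ⟨θ, hθ, h'⟩ := mem_noms_bigAnd.1 h'
      exact (hj s t).2 θ (hMX θ hθ) h'
    · intro S hS
      refine Der.of_isThVal _ fun v hv => ?_
      have := hv.der _ (hd S hS)
      simp only [hv.imp, hv.neg, hv.bigAnd] at this ⊢
      exact fun hp hMv => this hp fun θ hθ => hMv θ (hM S θ hθ)
  obtain ⟨v, hv, hvX⟩ := h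
  have := hv.der _ hder
  simp only [hv.imp, hv.neg, hv.bigAnd] at this
  exact this (hvX _ hX) fun θ hθ => hvX θ (hMX θ hθ)

/-- Truth assignments in which all satisfied `@_i ♥(φ₁, …, φₙ)` have witnesses. -/
def IsPasted (L : Axiomatization Λ) (v : Form Λ b 0 → Prop) : Prop :=
  ∀ (i : ℕ) (o : Λ.Op) (φ : Fin (Λ.ar o) → Form Λ b 0), v (atN i (op o φ)) →
    ∃ j S, S.Nonempty ∧ v (pasteHyp o (L.bound o) φ i j S)

/-- One stage of the construction. Only finitely many formulas are added, so infinitely many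
nominals stay fresh. -/
theorem IsConsistent.exists_decide {X : Set (Form Λ b 0)} (h : IsConsistent L A Φ X)
    (hfr : (freshNoms Φ X).Infinite) (θ : Form Λ b 0) :
    ∃ X', X ⊆ X' ∧ IsConsistent L A Φ X' ∧ (freshNoms Φ X').Infinite ∧
      (neg θ ∈ X' ∨ ∀ i o φ, θ = atN i (op o φ) →
        ∃ j S, S.Nonempty ∧ pasteHyp o (L.bound o) φ i j S ∈ X') := by
  by_cases hθ : IsConsistent L A Φ (insert θ X)
  · have hfr' := freshNoms_insert_infinite hfr θ
    by_cases hs : ∃ i o φ, θ = atN i (op o φ)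
    · obtain ⟨i, o, φ, rfl⟩ := hs
      obtain ⟨j, S, hS, hc⟩ := hθ.exists_paste hfr' (Set.mem_insert _ _)
      refine ⟨_, (Set.subset_insert _ X).trans (Set.subset_insert _ _), hc,
        freshNoms_insert_infinite hfr' _, Or.inr ?_⟩
      intro i' o' φ' heq
      cases heq
      exact ⟨j, S, hS, Set.mem_insert _ _⟩
    · exact ⟨_, Set.subset_insert _ X, hθ, hfr', Or.inr fun i o φ h => absurd ⟨i, o, φ, h⟩ hs⟩
  · obtain ⟨v, hv, hX⟩ := h
    refine ⟨_, Set.subset_insert (neg θ) X, ⟨v, hv, fun χ hχ => ?_⟩,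
      freshNoms_insert_infinite hfr _, Or.inl (Set.mem_insert _ _)⟩
    rcases Set.mem_insert_iff.1 hχ with rfl | hχ
    · rw [hv.neg]
      refine fun hvθ => hθ ⟨v, hv, fun χ hχ => ?_⟩
      rcases Set.mem_insert_iff.1 hχ with rfl | hχ
      · exact hvθ
      · exact hX χ hχ
    · exact hX χ hχ

/-- Every formula is treated at some stage, and the union of the stages is consistent by finiteness.
Any assignment satisfying the union is pasted: a true `@_i ♥` cannot have been negated, hence
received witnesses. -/
theorem IsConsistent.exists_isPasted {X : Set (Form Λ b 0)} (h : IsConsistent L A Φ X)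
    (hfr : (freshNoms Φ X).Infinite) :
    ∃ v, IsThVal L A Φ v ∧ IsPasted L v ∧ ∀ θ ∈ X, v θ := by
  have : Nonempty (Form Λ b 0) := ⟨.bot⟩
  obtain ⟨f, hf⟩ := exists_surjective_nat (Form Λ b 0)
  let St : Type := {Y : Set (Form Λ b 0) // IsConsistent L A Φ Y ∧ (freshNoms Φ Y).Infinite}
  have hstep : ∀ (n : ℕ) (Y : St), ∃ Y' : St, Y.1 ⊆ Y'.1 ∧ (neg (f n) ∈ Y'.1 ∨
      ∀ i o φ, f n = atN i (op o φ) →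
        ∃ j S, S.Nonempty ∧ pasteHyp o (L.bound o) φ i j S ∈ Y'.1) := by
    intro n Y
    obtain ⟨Y', h₁, h₂, h₃, h₄⟩ := Y.2.1.exists_decide Y.2.2 (f n)
    exact ⟨⟨Y', h₂, h₃⟩, h₁, h₄⟩
  choose step hsub hdec using hstep
  let Z : ℕ → St := fun n => Nat.rec ⟨X, h, hfr⟩ step n
  have hmono : Monotone fun n => (Z n).1 := monotone_nat_of_le_succ fun n => hsub n (Z n)
  have hU : IsConsistent L A Φ (⋃ n, (Z n).1) := by
    by_contra hcon
    obtain ⟨l, hl, hd⟩ := exists_der_neg_bigAnd _ hcon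
    obtain ⟨n, hn⟩ : ∃ n, ∀ θ ∈ l, θ ∈ (Z n).1 := by
      clear hd
      induction l with
      | nil => exact ⟨0, by simp⟩
      | cons θ l ih =>
        obtain ⟨n, hn⟩ := ih fun χ hχ => hl χ (by simp [hχ])
        obtain ⟨m, hm⟩ := Set.mem_iUnion.1 (hl θ (by simp))
        refine ⟨max n m, fun χ hχ => ?_⟩
        rcases List.mem_cons.1 hχ with rfl | hχ
        · exact hmono (le_max_right n m) hm
        · exact hmono (le_max_left n m) (hn χ hχ)
    obtain ⟨v, hv, hZ⟩ := (Z n).2.1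
    have := hv.der _ hd
    rw [hv.neg, hv.bigAnd] at this
    exact this fun θ hθ => hZ θ (hn θ hθ)
  obtain ⟨v, hv, hvU⟩ := hU
  have hvZ : ∀ n, ∀ θ ∈ (Z n).1, v θ := fun n θ hθ => hvU θ (Set.mem_iUnion.2 ⟨n, hθ⟩)
  refine ⟨v, hv, fun i o φ hop => ?_, hvZ 0⟩
  obtain ⟨n, hn⟩ := hf (atN i (op o φ))
  rcases hdec n (Z n) with h' | h'
  · rw [hn] at h'
    exact absurd hop ((hv.neg _).1 (hvZ (n + 1) _ h'))
  · obtain ⟨j, S, hS, hp⟩ := h' i o φ hn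
    exact ⟨j, S, hS, hvZ (n + 1) _ hp⟩

/-- If `φ` is not derivable, then after doubling all nominals there is a pasted truth assignment
that refutes `φ` at some nominal. -/
theorem exists_isPasted_of_not_derivesLoc {Φ Ψ : Set (Form Λ b 0)} {φ : Form Λ b 0}
    (h : ¬ DerivesLoc L A Φ Ψ φ) :
    ∃ (v : Form Λ b 0 → Prop) (i : ℕ), IsThVal L A (Form.rename (2 * ·) '' Φ) v ∧
      IsPasted L v ∧ (∀ ψ ∈ Ψ, v (atN i (ψ.rename (2 * ·)))) ∧
      ¬ v (atN i (φ.rename (2 * ·))) := by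
  classical
  let D : Form Λ b 0 → Form Λ b 0 := Form.rename (2 * ·)
  have hD : ∀ χ : Form Λ b 0, ∀ x ∈ (D χ).noms, Even x := by
    intro χ x hx
    rw [Form.noms_rename] at hx
    obtain ⟨y, _, rfl⟩ := hx
    exact even_two_mul y
  have hodd : ∀ (χ : Form Λ b 0) (x : ℕ), 2 * x + 1 ∉ (D χ).noms := fun χ x hx =>
    (Nat.not_even_iff_odd.2 (odd_two_mul_add_one x)) (hD χ _ hx)
  have h' : ∀ l : List (Form Λ b 0), (∀ ψ ∈ l, ψ ∈ Ψ) →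
      ¬ Der L A (D '' Φ) (imp (bigAnd (l.map D)) (D φ)) := by
    intro l hl hd
    obtain ⟨Φ₀, hΦ₀, hfin, hd⟩ := hd.exists_finite
    replace hd := hd Φ₀ subset_rfl hΦ₀
    let T : Set ℕ := (⋃ χ ∈ Φ₀, χ.noms) ∪ (⋃ χ ∈ {χ | χ ∈ φ :: l}, (D χ).noms)
    have hT : T.Finite := (hfin.biUnion fun χ _ => χ.noms_finite).union
      ((List.finite_toSet _).biUnion fun χ _ => (D χ).noms_finite)
    have hTe : ∀ x ∈ T, Even x := by
      rintro x (hx | hx)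
      · obtain ⟨χ, hχ, hx⟩ := Set.mem_iUnion₂.1 hx
        obtain ⟨χ', _, rfl⟩ := hΦ₀ hχ
        exact hD χ' x hx
      · obtain ⟨χ, hχ, hx⟩ := Set.mem_iUnion₂.1 hx
        exact hD χ x hx
    obtain ⟨M, hM⟩ := hT.bddAbove
    -- Undoes the doubling on the finite set `T` of relevant nominals, which are all even, and moves
    -- the others beyond `M`. This is injective, as renaming of derivations requires; plain halving
    -- is not.
    let τ : ℕ → ℕ := fun x => if x ∈ T then x / 2 else x + M + 1
    have hτ : Function.Injective τ := by
      intro x y hxy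
      simp only [τ] at hxy
      split_ifs at hxy with hx hy hy
      · obtain ⟨x', rfl⟩ := hTe x hx
        obtain ⟨y', rfl⟩ := hTe y hy
        omega
      · have := hM hx
        omega
      · have := hM hy
        omega
      · omega
    have hτD : ∀ χ, (∀ x ∈ (D χ).noms, x ∈ T) → (D χ).rename τ = χ := by
      intro χ hχ
      rw [Form.rename_rename]
      refine Form.rename_eq_self _ _ fun i hi => ?_
      have : 2 * i ∈ T := hχ _ (by rw [Form.noms_rename]; exact ⟨i, hi, rfl⟩)
      simp [τ, this]
    have hτl : ∀ χ ∈ φ :: l, (D χ).rename τ = χ := fun χ hχ =>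
      hτD χ fun x hx => Or.inr (Set.mem_iUnion₂.2 ⟨χ, hχ, hx⟩)
    have hd' := hd.rename hτ
    have heq : (imp (bigAnd (l.map D)) (D φ)).rename τ = imp (bigAnd l) φ := by
      unfold Form.rename
      rw [Form.map_imp, Form.map_bigAnd, List.map_map]
      congr 1
      · congr 1
        refine (List.map_congr_left fun χ hχ => hτl χ (by simp [hχ])).trans (List.map_id' l)
      · exact hτl φ (by simp)
    rw [heq] at hd'
    refine h ⟨l, hl, _, ?_, hfin.image _, hd'⟩
    rintro _ ⟨χ, hχ, rfl⟩
    obtain ⟨χ', hχ', rfl⟩ := hΦ₀ hχ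
    rwa [hτD χ' fun x hx => Or.inl (Set.mem_iUnion₂.2 ⟨_, hχ, hx⟩)]
  -- The odd nominal 1 names the refuting state, and `Name` shows that adding it is harmless. The
  -- other odd nominals remain available for pasting.
  let X : Set (Form Λ b 0) := insert (nom 1) (insert (neg (D φ)) (D '' Ψ))
  have hX : IsConsistent L A (D '' Φ) X := by
    by_contra hcon
    obtain ⟨l, hl, hd⟩ := exists_der_neg_bigAnd _ hcon
    obtain ⟨l', hl', hll'⟩ : ∃ l' : List (Form Λ b 0), (∀ ψ ∈ l', ψ ∈ Ψ) ∧
        ∀ θ ∈ l, θ ∈ D '' Ψ → θ ∈ l'.map D := by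
      have hg : ∀ θ, ∃ ψ, θ ∈ D '' Ψ → ψ ∈ Ψ ∧ D ψ = θ := fun θ => by
        by_cases hθ : θ ∈ D '' Ψ
        · exact ⟨hθ.choose, fun _ => hθ.choose_spec⟩
        · exact ⟨.bot, fun h => absurd h hθ⟩
      choose g hg using hg
      refine ⟨(l.filter (· ∈ D '' Ψ)).map g, fun ψ hψ => ?_, fun θ hθ hθ' => ?_⟩
      · obtain ⟨θ, hθ, rfl⟩ := List.mem_map.1 hψ
        exact (hg θ (of_decide_eq_true (List.mem_filter.1 hθ).2)).1
      · exact List.mem_map.2 ⟨g θ, List.mem_map.2 ⟨θ, List.mem_filter.2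
          ⟨hθ, decide_eq_true hθ'⟩, rfl⟩, (hg θ hθ').2⟩
    refine h' l' hl' (Der.name 1 _ ?_ ?_ (Der.of_isThVal _ fun v hv => ?_))
    · rintro (h₁ | h₁)
      · obtain ⟨χ, hχ, h₁⟩ := mem_noms_bigAnd.1 h₁
        obtain ⟨χ', _, rfl⟩ := List.mem_map.1 hχ
        exact hodd χ' 0 h₁
      · exact hodd φ 0 h₁
    · rintro _ ⟨χ, _, rfl⟩
      exact hodd χ 0
    · have := hv.der _ hd
      simp only [hv.imp, hv.neg, hv.bigAnd] at this ⊢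
      intro h₁ h₂
      by_contra h₃
      refine this fun θ hθ => ?_
      rcases hl θ hθ with rfl | rfl | hθ'
      · exact h₁
      · exact (hv.neg _).2 h₃
      · exact h₂ θ (hll' θ hθ hθ')
  have hfr : (freshNoms (D '' Φ) X).Infinite := by
    refine Set.infinite_of_injective_forall_mem (f := fun n : ℕ => 2 * (n + 1) + 1)
      (fun x y hxy => by simpa using hxy) fun n => ⟨?_, ?_⟩
    · rintro _ ⟨χ, _, rfl⟩
      exact hodd χ _
    · rintro _ (rfl | rfl | ⟨χ, _, rfl⟩)
      · intro h₁
        have : (Sum.inl 1 : Lbl 0) = Sum.inl (2 * (n + 1) + 1) := h₁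
        have := Sum.inl.inj this
        omega
      · exact hodd φ _
      · exact hodd χ _
  obtain ⟨v, hv, hp, hvX⟩ := hX.exists_isPasted hfr
  have h1 : v (nom 1) := hvX _ (Set.mem_insert _ _)
  refine ⟨v, 1, hv, hp, fun ψ hψ => ?_, fun h₁ => ?_⟩
  · exact (hv.atN_of_nom h1 _).2 (hvX _ (Or.inr (Or.inr ⟨ψ, hψ, rfl⟩)))
  · exact (hv.neg _).1 (hvX _ (Or.inr (Or.inl rfl))) ((hv.atN_of_nom h1 _).1 h₁)

end Lindenbaum

/-- A logic of counting operators with the counting rules and paste bounds given by thresholds;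
`D r m` says that there are more than `m` successors for the role `r`. -/
structure IsCountingLogic {ρ : Type} {Λ : SimType} (role : Λ.Op → ρ)
    (coeff : ∀ o, Fin (Λ.ar o) → ℕ) (thr : Λ.Op → ℕ) (D : ρ → ℕ → Λ.Op) (L : Axiomatization Λ) :
    Prop where
  ar_pos : ∀ o, 0 < Λ.ar o
  rules : L.rules = countingRules Λ role coeff thr
  bound : L.bound = thr
  coeff_pos : ∀ o s, 0 < coeff o s
  role_dia : ∀ r m, role (D r m) = r
  coeff_dia : ∀ r m, ∑ s, coeff (D r m) s = 1
  thr_dia : ∀ r m, thr (D r m) = m + 1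

/-! ### Counting rules relative to facts about named states -/

section Canonical

variable {ρ : Type} {Λ : SimType} {b : Bool} {role : Λ.Op → ρ}
  {coeff : ∀ o, Fin (Λ.ar o) → ℕ} {thr : Λ.Op → ℕ} {D : ρ → ℕ → Λ.Op} {L : Axiomatization Λ}
  {A Φ : Set (Form Λ b 0)} {v : Form Λ b 0 → Prop}

/-- Facts about named states can be collected in a single such fact. -/
theorem exists_common_fact (hv : IsThVal L A Φ v) {E : Set (ℕ × Form Λ b 0)} (hE : E.Finite)
    (h : ∀ p ∈ E, v (atN p.1 p.2)) :
    ∃ χ, v (atN 0 χ) ∧ ∀ u, IsThVal L A Φ u → u (atN 0 χ) → ∀ p ∈ E, u (atN p.1 p.2) := by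
  -- The choice of the nominal 0 is immaterial by `atN_atN`; the prefix `@_0` gives the conjunction
  -- the shape that `mob` accepts.
  refine ⟨Form.bigAnd (hE.toFinset.toList.map fun p => atN p.1 p.2), ?_, fun u hu h' p hp => ?_⟩
  · refine ((hv.atN 0).bigAnd _).2 fun θ hθ => ?_
    obtain ⟨p, hp, rfl⟩ := List.mem_map.1 hθ
    exact (hv.atN_atN _ _ _).2 (h p (by simpa using hp))
  · exact (hu.atN_atN _ _ _).1 (((hu.atN 0).bigAnd _).1 h' _
      (List.mem_map.2 ⟨p, by simpa using hp, rfl⟩))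

/-- The counting rules at a named state, relative to facts about finitely many named states. -/
theorem IsCountingLogic.counting_at [Countable Λ.Op]
    (hL : IsCountingLogic role coeff thr D L) (hv : IsThVal L A Φ v) {E : Set (ℕ × Form Λ b 0)}
    (hE : E.Finite) (hvE : ∀ p ∈ E, v (atN p.1 p.2)) (r : ρ) (Γ Δ : List (ℕ × ModalForm Λ b))
    (hr : ∀ x ∈ Γ ++ Δ, role x.2.1 = r)
    (hle : ∀ u, IsThVal L A Φ u → (∀ p ∈ E, u (atN p.1 p.2)) →
      (Γ.map fun x => x.1 * trueCount coeff u x.2).sum ≤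
        (Δ.map fun x => x.1 * trueCount coeff u x.2).sum)
    (hlt : (Δ.map fun x => x.1 * thr x.2.1).sum <
      (Γ.map fun x => x.1 * thr x.2.1).sum + (Δ.map fun x => x.1).sum)
    (i : ℕ) (hΓ : ∀ x ∈ Γ, v (atN i (op x.2.1 x.2.2))) :
    ∃ x ∈ Δ, v (atN i (op x.2.1 x.2.2)) := by
  classical
  obtain ⟨χ, hχ, hE'⟩ := exists_common_fact hv hE hvE
  -- The facts are conjoined to every argument. Under an assignment that violates them all counts
  -- become 0, so the inequality is needed only where they hold.
  let f : ℕ × ModalForm Λ b → ℕ × ModalForm Λ b := fun x =>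
    (x.1, ⟨x.2.1, fun s => Form.and (atN 0 χ) (x.2.2 s)⟩)
  have hf : ∀ x, v (atN i (op x.2.1 x.2.2)) ↔ v (atN i (op (f x).2.1 (f x).2.2)) := fun x =>
    hv.atN_op_and i 0 hχ x.2.1 x.2.2
  have hd := Der.counting (L := L) (A := A) (Φ := Φ) hL.rules r (Γ.map f) (Δ.map f) (by
      rw [← List.map_append]
      intro x hx
      obtain ⟨y, hy, rfl⟩ := List.mem_map.1 hx
      exact hr y hy) (by
      intro u hu
      simp only [List.map_map]
      by_cases hχu : u (atN 0 χ)
      · have : ∀ x, trueCount coeff u (f x).2 = trueCount coeff u x.2 := fun x => by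
          simp [trueCount, f, hu.and, hχu]
        simpa only [Function.comp_def, this] using hle u hu (hE' u hu hχu)
      · have : ∀ x, trueCount coeff u (f x).2 = 0 := fun x => by
          simp [trueCount, f, hu.and, hχu]
        simp [Function.comp_def, this]) (by
      simp only [List.map_map]
      exact hlt)
  have hi := hv.atN i
  have := (hi.imp _ _).1 (hi.der _ hd)
  rw [hi.bigAnd, hi.bigOr] at this
  obtain ⟨θ, hθ, hvθ⟩ := this fun θ hθ => by
    obtain ⟨y, hy, rfl⟩ := List.mem_map.1 hθ
    obtain ⟨x, hx, rfl⟩ := List.mem_map.1 hy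
    exact (hf x).1 (hΓ x hx)
  obtain ⟨y, hy, rfl⟩ := List.mem_map.1 hθ
  obtain ⟨x, hx, rfl⟩ := List.mem_map.1 hy
  exact ⟨x, hx, (hf x).2 hvθ⟩

open Classical in
theorem IsCountingLogic.trueCount_dia (hL : IsCountingLogic role coeff thr D L)
    (u : Form Λ b 0 → Prop) (r : ρ) (m : ℕ)
    (θ : Form Λ b 0) :
    trueCount coeff u ⟨D r m, fun _ => θ⟩ = (decide (u θ)).toNat := by
  change ∑ s, coeff (D r m) s * (decide (u θ)).toNat = _
  rw [← Finset.sum_mul, hL.coeff_dia, one_mul]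

end Canonical

/-- The multigraph on named states determined by a truth assignment `v`; `nm c` names `c`. -/
noncomputable def canonGraph {ρ : Type} {Λ : SimType} {b : Bool} (D : ρ → ℕ → Λ.Op)
    (v : Form Λ b 0 → Prop) {C : Type u} (nm : C → ℕ) (c : C) (r : ρ) (d : C) : ℕ∞ :=
  ⨆ m : ℕ, ⨆ _ : v (atN (nm c) (op (D r m) fun _ => nom (nm d))), ((m + 1 : ℕ) : ℕ∞)

/-- `C` consists of the states named by nominals, identified according to `v`. -/
structure IsNaming {Λ : SimType} {b : Bool} (v : Form Λ b 0 → Prop) {C : Type u} (nm : C → ℕ)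
    (cl : ℕ → C) : Prop where
  nm_cl : ∀ i, v (atN (nm (cl i)) (nom i))
  eq_of_nm : ∀ c d, v (atN (nm c) (nom (nm d))) → c = d

/-! ### Canonical model and truth lemma -/

section CanonicalModel

variable {ρ : Type} {Λ : SimType} {b : Bool} {role : Λ.Op → ρ}
  {coeff : ∀ o, Fin (Λ.ar o) → ℕ} {thr : Λ.Op → ℕ} {D : ρ → ℕ → Λ.Op} {L : Axiomatization Λ}
  {A Φ : Set (Form Λ b 0)} {v : Form Λ b 0 → Prop} {C : Type u} {nm : C → ℕ} {cl : ℕ → C}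

theorem IsNaming.cl_nm (hn : IsNaming v nm cl) (c : C) : cl (nm c) = c :=
  hn.eq_of_nm _ _ (hn.nm_cl (nm c))

theorem IsNaming.atN_nm_cl (hn : IsNaming v nm cl) (hv : IsThVal L A Φ v) (i : ℕ)
    (φ : Form Λ b 0) : v (atN (nm (cl i)) φ) ↔ v (atN i φ) :=
  hv.atN_congr φ (hn.nm_cl i)

theorem le_canonGraph {c d : C} {r : ρ} {m : ℕ}
    (h : v (atN (nm c) (op (D r m) fun _ => nom (nm d)))) :
    ((m + 1 : ℕ) : ℕ∞) ≤ canonGraph D v nm c r d :=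
  le_iSup₂ (f := fun (m : ℕ) (_ : v (atN (nm c) (op (D r m) fun _ => nom (nm d)))) =>
    ((m + 1 : ℕ) : ℕ∞)) m h

theorem exists_of_le_canonGraph {c d : C} {r : ρ} {t : ℕ} (ht : t ≠ 0)
    (h : (t : ℕ∞) ≤ canonGraph D v nm c r d) :
    ∃ m, t ≤ m + 1 ∧ v (atN (nm c) (op (D r m) fun _ => nom (nm d))) := by
  obtain ⟨t, rfl⟩ := Nat.exists_eq_succ_of_ne_zero ht
  have h' : (t : ℕ∞) < canonGraph D v nm c r d := by
    refine lt_of_lt_of_le ?_ h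
    exact_mod_cast Nat.lt_succ_self t
  simp only [canonGraph, lt_iSup_iff] at h'
  obtain ⟨m, hm, h'⟩ := h'
  exact ⟨m, by exact_mod_cast h', hm⟩

variable [Countable Λ.Op]

/-- Finitely many successors `d` already reach the threshold. The rule is used with `Γ` consisting
of true diamonds `⟨m d⟩ d`, weighted by the total coefficient `w d` of the arguments true at `d`,
and `Δ` consisting of the operator with weight 1. The side condition becomes `thr < ∑ w d · (m d +
1) + 1`. -/
theorem IsCountingLogic.atN_op_of_le (hL : IsCountingLogic role coeff thr D L)
    (hv : IsThVal L A Φ v) (hn : IsNaming v nm cl) (c : C)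
    (o : Λ.Op) (φ : Fin (Λ.ar o) → Form Λ b 0)
    (h : (thr o : ℕ∞) ≤ ∑ s, (coeff o s : ℕ∞) *
      weight (canonGraph D v nm c (role o)) {d | v (atN (nm d) (φ s))}) :
    v (atN (nm c) (op o φ)) := by
  classical
  let B := canonGraph D v nm c (role o)
  let Y : Fin (Λ.ar o) → Set C := fun s => {d | v (atN (nm d) (φ s))}
  obtain ⟨F, hF⟩ := (le_sum_partWeight B (coeff o) Y le_rfl h).exists
  -- Successors of multiplicity 0 are dropped, since no diamond witnesses them.
  let F' : Finset C := F.filter fun d => trunc B (thr o) d ≠ 0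
  have hm : ∀ d, ∃ m, d ∈ F' → trunc B (thr o) d ≤ m + 1 ∧
      v (atN (nm c) (op (D (role o) m) fun _ => nom (nm d))) := by
    intro d
    by_cases hd : d ∈ F'
    · obtain ⟨m, hm⟩ := exists_of_le_canonGraph (Finset.mem_filter.1 hd).2
        ((natCast_trunc B (thr o) d).trans_le (min_le_left _ _))
      exact ⟨m, fun _ => hm⟩
    · exact ⟨0, fun h => absurd h hd⟩
  choose m hm using hm
  let w : C → ℕ := fun d => ∑ s, coeff o s * (decide (d ∈ Y s)).toNat
  -- The facts used: which arguments hold at which `d`, and that distinct `d` have incompatible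
  -- names. Hence at most one name is true at a time, and it forces the arguments counted in `w d`.
  let E : Set (ℕ × Form Λ b 0) :=
    (fun p : C × Fin (Λ.ar o) => (nm p.1, φ p.2)) '' {p | p.1 ∈ F' ∧ p.1 ∈ Y p.2} ∪
    (fun p : C × C => (nm p.1, neg (nom (nm p.2)))) '' {p | p.1 ∈ F' ∧ p.2 ∈ F' ∧ p.1 ≠ p.2}
  have hE : E.Finite := by
    refine Set.Finite.union (Set.Finite.image _ ?_) (Set.Finite.image _ ?_)
    · exact (F'.finite_toSet.prod Set.finite_univ).subset fun p hp => ⟨hp.1, trivial⟩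
    · exact (F'.finite_toSet.prod F'.finite_toSet).subset fun p hp => ⟨hp.1, hp.2.1⟩
  have hvE : ∀ p ∈ E, v (atN p.1 p.2) := by
    rintro _ (⟨p, hp, rfl⟩ | ⟨p, hp, rfl⟩)
    · exact hp.2
    · exact ((hv.atN _).neg _).2 fun h' => hp.2.2 (hn.eq_of_nm _ _ h')
  refine Exists.elim (hL.counting_at hv hE hvE (role o)
    (F'.toList.map fun d => (w d, ⟨D (role o) (m d), fun _ => nom (nm d)⟩)) [(1, ⟨o, φ⟩)] ?_ ?_ ?_
    (nm c) ?_) ?_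
  · intro x hx
    rcases List.mem_append.1 hx with hx | hx
    · obtain ⟨d, _, rfl⟩ := List.mem_map.1 hx
      exact hL.role_dia _ _
    · rw [List.mem_singleton.1 hx]
  · intro u hu huE
    simp only [List.map_map, Function.comp_def, hL.trueCount_dia, Finset.sum_map_toList,
      List.map_cons, List.map_nil, List.sum_singleton, one_mul]
    by_cases h0 : ∃ d ∈ F', u (nom (nm d))
    · obtain ⟨d, hd, hud⟩ := h0
      rw [Finset.sum_eq_single d]
      · simp only [hud, decide_true, Bool.toNat_true, mul_one, w, trueCount]
        refine Finset.sum_le_sum fun s _ => Nat.mul_le_mul_left _ ?_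
        by_cases hs : d ∈ Y s
        · have := (hu.atN_of_nom hud _).1 (huE _ (Or.inl ⟨(d, s), ⟨hd, hs⟩, rfl⟩))
          simp only at this
          simp [this, Bool.toNat_le]
        · simp [hs]
      · intro d' hd' hne
        have := (hu.atN_of_nom hud _).1 (huE _ (Or.inr ⟨(d, d'), ⟨hd, hd', hne.symm⟩, rfl⟩))
        simp [(hu.neg _).1 this]
      · exact fun h' => absurd hd h'
    · push Not at h0
      rw [Finset.sum_eq_zero fun d hd => by simp [h0 d hd]]
      exact Nat.zero_le _
  · simp only [List.map_map, Function.comp_def, Finset.sum_map_toList, hL.thr_dia,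
      List.map_cons, List.map_nil, List.sum_singleton, one_mul]
    refine Nat.lt_succ_of_le (hF.trans ?_)
    calc ∑ s, coeff o s * partWeight B (thr o) F (Y s)
        = ∑ d ∈ F, w d * trunc B (thr o) d := by
          simp only [partWeight, w, Finset.mul_sum, Finset.sum_mul]
          rw [Finset.sum_comm]
          exact Finset.sum_congr rfl fun d _ => Finset.sum_congr rfl fun s _ => by ring
      _ = ∑ d ∈ F', w d * trunc B (thr o) d := by
          refine (Finset.sum_filter_of_ne fun d _ h' => ?_).symm
          exact right_ne_zero_of_mul h'
      _ ≤ ∑ d ∈ F', w d * (m d + 1) :=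
          Finset.sum_le_sum fun d hd => Nat.mul_le_mul_left _ (hm d hd).1
  · intro x hx
    obtain ⟨d, hd, rfl⟩ := List.mem_map.1 hx
    exact (hm d (Finset.mem_toList.1 hd)).2
  · rintro x ⟨hx, hvx⟩
    rw [List.mem_singleton] at hx
    rwa [hx] at hvx

/-- If the sum stayed below the threshold, so would the contribution of the paste witnesses, and
their multiplicities `B d` would be finite. The rule with `Γ` the operator applied to disjunctions
of witnesses and `Δ` the diamonds `⟨B d⟩ d` with weights `w d` has side condition `∑ w d · B d <
thr`. It yields a true `⟨B d⟩ d`, contradicting the definition of `B d` as a supremum. -/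
theorem IsCountingLogic.le_of_atN_op (hL : IsCountingLogic role coeff thr D L)
    (hv : IsThVal L A Φ v) (hn : IsNaming v nm cl) (hp : IsPasted L v) (c : C) (o : Λ.Op)
    (φ : Fin (Λ.ar o) → Form Λ b 0) (h : v (atN (nm c) (op o φ))) :
    (thr o : ℕ∞) ≤ ∑ s, (coeff o s : ℕ∞) *
      weight (canonGraph D v nm c (role o)) {d | v (atN (nm d) (φ s))} := by
  classical
  let B := canonGraph D v nm c (role o)
  let Y : Fin (Λ.ar o) → Set C := fun s => {d | v (atN (nm d) (φ s))}
  by_contra hcon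
  rw [not_le] at hcon
  obtain ⟨j, S, -, hpj⟩ := hp (nm c) o φ h
  obtain ⟨hjS, hop⟩ := (hv.pasteHyp _ _ _ _ _ _).1 hpj
  let Z : Fin (Λ.ar o) → Finset C := fun s =>
    if s ∈ S then Finset.univ.image fun t => cl (j s t) else ∅
  have hZ : ∀ s, (Z s : Set C) ⊆ Y s := by
    intro s d hd
    by_cases hs : s ∈ S
    · simp only [Z, if_pos hs, Finset.coe_image, Finset.coe_univ, Set.image_univ] at hd
      obtain ⟨t, rfl⟩ := hd
      exact (hn.atN_nm_cl hv _ _).2 (hjS s hs t)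
    · simp [Z, hs] at hd
  have hle : ∀ s, weight B (Y s) ≤ (coeff o s : ℕ∞) * weight B (Y s) := fun s =>
    le_mul_of_one_le_left zero_le (by exact_mod_cast hL.coeff_pos o s)
  have hfin : ∀ s, ∀ d ∈ Z s, B d ≠ ⊤ := by
    intro s d hd
    have h₁ : B d ≤ weight B (Y s) := by
      simpa using sum_le_weight B (Y := Y s) {d} (by simpa using hZ s hd)
    have h₂ := Finset.single_le_sum (f := fun s => (coeff o s : ℕ∞) * weight B (Y s))
      (fun _ _ => zero_le) (Finset.mem_univ s)
    exact ((h₁.trans (hle s)).trans h₂).trans_lt hcon |>.ne_top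
  let F : Finset C := Finset.univ.biUnion Z
  have hZF : ∀ s, Z s ⊆ F := fun s => Finset.subset_biUnion_of_mem Z (Finset.mem_univ s)
  have hBF : ∀ d ∈ F, ((B d).toNat : ℕ∞) = B d := by
    intro d hd
    obtain ⟨s, _, hd⟩ := Finset.mem_biUnion.1 hd
    exact ENat.natCast_toNat (hfin s d hd)
  let w : C → ℕ := fun d => ∑ s, coeff o s * (decide (d ∈ Z s)).toNat
  have hw : ∀ m : C → ℕ, ∑ d ∈ F, w d * m d = ∑ s, coeff o s * ∑ d ∈ Z s, m d := by
    intro m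
    simp only [w, Finset.sum_mul]
    rw [Finset.sum_comm]
    refine Finset.sum_congr rfl fun s _ => ?_
    rw [Finset.mul_sum, ← Finset.sum_subset (hZF s) fun d _ hd => by simp [hd]]
    exact Finset.sum_congr rfl fun d hd => by simp [hd]
  have hwlt : ∑ d ∈ F, w d * (B d).toNat < thr o := by
    have : ((∑ d ∈ F, w d * (B d).toNat : ℕ) : ℕ∞) < thr o := by
      refine lt_of_le_of_lt ?_ hcon
      rw [hw]
      push_cast
      refine Finset.sum_le_sum fun s _ => ?_
      gcongr
      rw [Finset.sum_congr rfl fun d hd => hBF d (hZF s hd)]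
      exact sum_le_weight B (Z s) (hZ s)
    exact_mod_cast this
  -- Witness nominals are identified with the chosen names of their states. Different witnesses may
  -- denote the same state, which is why `Z s` is a set of states.
  let E : Set (ℕ × Form Λ b 0) :=
    Set.range fun p : Fin (Λ.ar o) × Fin (L.bound o) => (j p.1 p.2, nom (nm (cl (j p.1 p.2))))
  have hvE : ∀ p ∈ E, v (atN p.1 p.2) := by
    rintro _ ⟨p, rfl⟩
    exact hv.atN_symm (hn.nm_cl _)
  refine Exists.elim (hL.counting_at hv (Set.finite_range _) hvE (role o)
    [(1, ⟨o, fun s => if s ∈ S then bigOr (List.ofFn fun r => nom (j s r)) else bot⟩)]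
    (F.toList.map fun d => (w d, ⟨D (role o) (B d).toNat, fun _ => nom (nm d)⟩)) ?_ ?_ ?_
    (nm c) ?_) ?_
  · intro x hx
    rcases List.mem_append.1 hx with hx | hx
    · rw [List.mem_singleton.1 hx]
    · obtain ⟨d, _, rfl⟩ := List.mem_map.1 hx
      exact hL.role_dia _ _
  · intro u hu huE
    simp only [List.map_map, Function.comp_def, hL.trueCount_dia, Finset.sum_map_toList,
      List.map_cons, List.map_nil, List.sum_singleton, one_mul]
    rw [hw]
    unfold trueCount
    refine Finset.sum_le_sum fun s _ => Nat.mul_le_mul_left _ ?_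
    by_cases hs : s ∈ S
    · simp only [if_pos hs]
      by_cases hus : u (bigOr (List.ofFn fun r => nom (j s r)))
      · obtain ⟨θ, hθ, huθ⟩ := (hu.bigOr _).1 hus
        obtain ⟨t, rfl⟩ := List.mem_ofFn.1 hθ
        have hmem : cl (j s t) ∈ Z s := by
          simp only [Z, if_pos hs]
          exact Finset.mem_image_of_mem _ (Finset.mem_univ t)
        have hnom := (hu.atN_of_nom huθ _).1 (huE _ ⟨(s, t), rfl⟩)
        refine le_trans ?_ (Finset.single_le_sum (fun _ _ => Nat.zero_le _) hmem)
        simp only at hnom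
        simp [hnom, Bool.toNat_le]
      · simp [hus]
    · simp [hs, hu.bot]
  · simp only [List.map_map, Function.comp_def, Finset.sum_map_toList, hL.thr_dia,
      List.map_cons, List.map_nil, List.sum_singleton, one_mul, mul_add, mul_one,
      Finset.sum_add_distrib]
    omega
  · intro x hx
    rw [List.mem_singleton.1 hx]
    exact hop
  · rintro x ⟨hx, hvx⟩
    obtain ⟨d, hd, rfl⟩ := List.mem_map.1 hx
    have h' : (((B d).toNat + 1 : ℕ) : ℕ∞) ≤ B d := le_canonGraph hvx
    rw [← hBF d (Finset.mem_toList.1 hd)] at h'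
    have : (B d).toNat + 1 ≤ (B d).toNat := by exact_mod_cast h'
    omega

/-- Truth lemma for the canonical model. -/
theorem IsCountingLogic.sat_canonGraph (hL : IsCountingLogic role coeff thr D L)
    (hv : IsThVal L A Φ v) (hn : IsNaming v nm cl) (hp : IsPasted L v) {n : ℕ} (φ : Form Λ b n)
    (f : Lbl n → ℕ) (c : C) :
    Sat (countingSem role coeff thr) (canonGraph D v nm) (fun p => {d | v (atN (nm d) (prop p))})
      (cl ∘ f) φ c ↔ v (atN (nm c) (φ.map (Sum.inl ∘ f))) := by
  have hc := hv.atN (nm c)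
  -- Free labels are replaced by nominals through `f`; the case of `↓` enters the body with one more
  -- label.
  induction φ generalizing c with
  | bot => exact iff_of_false id hc.bot
  | prop p => exact Iff.rfl
  | lab l =>
    refine ⟨?_, fun h => ?_⟩
    · rintro rfl
      exact hn.nm_cl _
    · refine hn.eq_of_nm _ _ (hv.atN_trans h (hv.atN_symm (hn.nm_cl (f l))))
  | and φ ψ ih₁ ih₂ => exact (and_congr (ih₁ f c hc) (ih₂ f c hc)).trans (hc.and _ _).symm
  | neg φ ih => exact (not_congr (ih f c hc)).trans (hc.neg _).symm
  | op o φ ih =>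
    have : ∀ s, {d | Sat (countingSem role coeff thr) (canonGraph D v nm)
        (fun p => {d | v (atN (nm d) (prop p))}) (cl ∘ f) (φ s) d} =
        {d | v (atN (nm d) ((φ s).map (Sum.inl ∘ f)))} := fun s =>
      Set.ext fun d => ih s f d (hv.atN _)
    simp only [Sat, this]
    exact ⟨hL.atN_op_of_le hv hn c o _, hL.le_of_atN_op hv hn hp c o _⟩
  | atL l φ ih =>
    refine (ih f (cl (f l)) (hv.atN _)).trans ?_
    rw [hn.atN_nm_cl hv]
    exact (hv.atN_atN (nm c) (f l) _).symm
  | down hb φ ih =>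
    -- The current state `c` is bound through its name `nm c`, matching the instance of `DA` at `nm
    -- c`.
    have h₁ : bindLbl (cl ∘ f) c = cl ∘ bindLbl f (nm c) := by
      funext l
      rcases l with i | x
      · rfl
      · refine Fin.cases (hn.cl_nm c).symm (fun y => rfl) x
    have h₂ : (φ.map (liftLbl (Sum.inl ∘ f))).inst (nm c) =
        φ.map (Sum.inl ∘ bindLbl f (nm c)) := by
      unfold Form.inst
      rw [Form.map_map]
      congr 1
      funext l
      rcases l with i | x
      · rfl
      · refine Fin.cases rfl (fun y => rfl) x
    have := ih (bindLbl f (nm c)) c hc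
    simp only [Sat, h₁]
    rw [← h₂] at this
    refine this.trans ((hc.iff _ _).1 (hv.der _ (Der.da hb (nm c) _))).symm

/-- The renaming `τ` has two uses: doubling, for the assumptions, and arbitrary substitution, for
pure axioms. -/
theorem IsCountingLogic.holds_canonGraph (hL : IsCountingLogic role coeff thr D L)
    (hv : IsThVal L A Φ v) (hn : IsNaming v nm cl) (hp : IsPasted L v)
    (φ : Form Λ b 0) (τ : ℕ → ℕ) (c : C) :
    Holds (countingSem role coeff thr) (canonGraph D v nm)
      (fun p => {d | v (atN (nm d) (prop p))}) (cl ∘ τ) φ c ↔ v (atN (nm c) (φ.rename τ)) := by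
  have h₁ : (Sum.elim (cl ∘ τ) Fin.elim0 : Lbl 0 → C) = cl ∘ Sum.elim τ Fin.elim0 := by
    funext l
    rcases l with i | x
    · rfl
    · exact x.elim0
  have h₂ : φ.rename τ = φ.map (Sum.inl ∘ Sum.elim τ Fin.elim0) := by
    unfold Form.rename
    congr 1
    funext l
    rcases l with i | x
    · rfl
    · exact x.elim0
  unfold Holds
  rw [h₁, h₂]
  exact hL.sat_canonGraph hv hn hp φ _ c

/-- Since every state is named, any valuation of nominals is the canonical one after a substitution,
and substitution instances of axioms are derivable. Purity makes the propositional part of the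
valuation irrelevant. -/
theorem IsCountingLogic.isFrame_canonGraph (hL : IsCountingLogic role coeff thr D L)
    (hv : IsThVal L A Φ v) (hn : IsNaming v nm cl) (hp : IsPasted L v) (hA : ∀ α ∈ A, α.IsPure) :
    IsFrame (countingSem role coeff thr) (canonGraph D v nm) A := by
  intro V ν α hα c
  have hν : ν = cl ∘ (nm ∘ ν) := funext fun i => (hn.cl_nm (ν i)).symm
  refine (sat_of_isPure (countingSem role coeff thr) (canonGraph D v nm) V
    (fun p => {d | v (atN (nm d) (prop p))}) _ α (hA α hα) c).2 ?_
  rw [hν]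
  exact (hL.holds_canonGraph hv hn hp α (nm ∘ ν) c).2 ((hv.atN _).der _ (Der.pureAx α _ hα))

end CanonicalModel

/-! ### Strong completeness for counting logics -/

section Completeness

variable {ρ : Type} {Λ : SimType} {b : Bool} {role : Λ.Op → ρ}
  {coeff : ∀ o, Fin (Λ.ar o) → ℕ} {thr : Λ.Op → ℕ} {D : ρ → ℕ → Λ.Op} {L : Axiomatization Λ}
  {A Φ : Set (Form Λ b 0)} {v : Form Λ b 0 → Prop}

/-- Nominals modulo true equality `@_i j`, with chosen representatives as names, lifted to the
required universe. -/
theorem exists_isNaming (hv : IsThVal L A Φ v) :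
    ∃ (C : Type u) (nm : C → ℕ) (cl : ℕ → C), Countable C ∧ IsNaming v nm cl := by
  let s : Setoid ℕ := ⟨fun i j => v (atN i (nom j)), hv.atN_self, hv.atN_symm, hv.atN_trans⟩
  have hout : ∀ i, v (atN (Quotient.mk s i).out (nom i)) := fun i => Quotient.mk_out (s := s) i
  refine ⟨ULift.{u} (Quotient s), fun c => c.down.out, fun i => ⟨Quotient.mk s i⟩,
    inferInstance, hout, fun c d h => ?_⟩
  have : Quotient.mk s c.down.out = Quotient.mk s d.down.out := Quotient.sound (s := s) h
  rw [Quotient.out_eq, Quotient.out_eq] at this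
  exact ULift.ext _ _ this

/-- Soundness and strong completeness of pure extensions of counting logics. -/
theorem IsCountingLogic.stronglyCompleteFor [Countable Λ.Op]
    (hL : IsCountingLogic role coeff thr D L) (hA : ∀ α ∈ A, α.IsPure) :
    StronglyCompleteFor (countingSem.{u} role coeff thr) L A
      (fun _ γ => IsFrame (countingSem role coeff thr) γ A) := by
  intro Φ Ψ φ
  have hsound : DerivesLoc L A Φ Ψ φ →
      Conseq (countingSem.{u} role coeff thr) (fun _ γ => IsFrame (countingSem role coeff thr) γ A)
        Φ Ψ φ := by
    rintro ⟨l, hl, Φ₀, hΦ₀, -, hd⟩ C γ hγ V ν hΦ c hΨ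
    have hc := isVal_holds (b := b) (countingSem role coeff thr) γ V ν c
    refine (hc.imp _ _).1 (hd.sound hL.ar_pos hL.rules.le hL.bound γ hγ V ν
      (fun χ hχ => hΦ χ (hΦ₀ hχ)) c) ((hc.bigAnd _).2 fun ψ hψ => hΨ ψ (hl ψ hψ))
  have hcomp : Conseq (countingSem.{u} role coeff thr)
      (fun C γ => Countable C ∧ IsFrame (countingSem role coeff thr) γ A) Φ Ψ φ →
        DerivesLoc L A Φ Ψ φ := by
    intro hcon
    by_contra hno
    obtain ⟨v, i, hv, hp, hΨ, hφ⟩ := exists_isPasted_of_not_derivesLoc hno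
    obtain ⟨C, nm, cl, hC, hn⟩ := exists_isNaming.{u} hv
    have key := fun χ c => hL.holds_canonGraph hv hn hp χ (2 * ·) c
    refine hφ ((hn.atN_nm_cl hv i _).1 ((key φ (cl i)).1 (hcon C (canonGraph D v nm)
      ⟨hC, hL.isFrame_canonGraph hv hn hp hA⟩ _ _ (fun χ hχ d => ?_) (cl i) fun ψ hψ => ?_)))
    · exact (key χ d).2 ((hv.atN _).der _ (Der.hyp _ ⟨χ, hχ, rfl⟩))
    · exact (key ψ (cl i)).2 ((hn.atN_nm_cl hv i _).2 (hΨ ψ hψ))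
  have hmono : Conseq (countingSem.{u} role coeff thr)
      (fun _ γ => IsFrame (countingSem role coeff thr) γ A) Φ Ψ φ →
      Conseq (countingSem.{u} role coeff thr)
        (fun C γ => Countable C ∧ IsFrame (countingSem role coeff thr) γ A) Φ Ψ φ :=
    fun h C γ hγ => h C γ hγ.2
  exact ⟨⟨hsound, hcomp ∘ hmono⟩, ⟨hmono ∘ hsound, hcomp⟩⟩

end Completeness

/-! ### Transfer of completeness between semantics -/

section Transfer

variable {Λ : SimType} {b : Bool}

/-- Truth depends on the transition structure only through the liftings, so structures of different
types can be compared. -/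
theorem sat_iff_of_lifting {S S' : Sem.{u} Λ} {C : Type u} {γ : C → S.T C} {γ' : C → S'.T C}
    (h : ∀ o Y c, γ c ∈ S.lifting o Y ↔ γ' c ∈ S'.lifting o Y) (V : ℕ → Set C) {n : ℕ}
    (g : Lbl n → C) (φ : Form Λ b n) (c : C) : Sat S γ V g φ c ↔ Sat S' γ' V g φ c := by
  induction φ generalizing c with
  | bot => rfl
  | prop p => rfl
  | lab l => rfl
  | and φ ψ ih₁ ih₂ => simp only [Sat, ih₁, ih₂]
  | neg φ ih => simp only [Sat, ih]
  | op o φ ih => simp only [Sat, ih, h]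
  | atL l φ ih => simp only [Sat, ih]
  | down hb φ ih => simp only [Sat, ih]

theorem isFrame_iff_of_lifting {S S' : Sem.{u} Λ} {C : Type u} {γ : C → S.T C} {γ' : C → S'.T C}
    (h : ∀ o Y c, γ c ∈ S.lifting o Y ↔ γ' c ∈ S'.lifting o Y) (A : Set (Form Λ b 0)) :
    IsFrame S γ A ↔ IsFrame S' γ' A := by
  unfold IsFrame Holds
  simp only [sat_iff_of_lifting h]

theorem Conseq.transfer {S S' : Sem.{u} Λ} {K : ∀ C : Type u, (C → S.T C) → Prop}
    {K' : ∀ C : Type u, (C → S'.T C) → Prop}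
    (h : ∀ C γ', K' C γ' → ∃ γ, K C γ ∧ ∀ o Y c, γ c ∈ S.lifting o Y ↔ γ' c ∈ S'.lifting o Y)
    {Φ Ψ : Set (Form Λ b 0)} {φ : Form Λ b 0} (hc : Conseq S K Φ Ψ φ) : Conseq S' K' Φ Ψ φ := by
  intro C γ' hγ' V ν hΦ c hΨ
  obtain ⟨γ, hγ, hl⟩ := h C γ' hγ'
  have key : ∀ (χ : Form Λ b 0) d, Holds S γ V ν χ d ↔ Holds S' γ' V ν χ d := fun χ d =>
    sat_iff_of_lifting hl V _ χ d
  exact (key φ c).1 (hc C γ hγ V ν (fun χ hχ d => (key χ d).2 (hΦ χ hχ d)) c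
    fun ψ hψ => (key ψ c).2 (hΨ ψ hψ))

theorem StronglyCompleteFor.transfer {S S' : Sem.{u} Λ} {L : Axiomatization Λ}
    {A : Set (Form Λ b 0)} {K : ∀ C : Type u, (C → S.T C) → Prop}
    {K' : ∀ C : Type u, (C → S'.T C) → Prop}
    (h : ∀ C γ, K C γ → ∃ γ', K' C γ' ∧ ∀ o Y c, γ c ∈ S.lifting o Y ↔ γ' c ∈ S'.lifting o Y)
    (h' : ∀ C γ', K' C γ' → ∃ γ, K C γ ∧ ∀ o Y c, γ c ∈ S.lifting o Y ↔ γ' c ∈ S'.lifting o Y)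
    (hc : StronglyCompleteFor S L A K) : StronglyCompleteFor S' L A K' := by
  intro Φ Ψ φ
  refine ⟨(hc Φ Ψ φ).1.trans ⟨Conseq.transfer h', Conseq.transfer fun C γ hγ => ?_⟩,
    (hc Φ Ψ φ).2.trans ⟨Conseq.transfer fun C γ hγ => ?_, Conseq.transfer fun C γ hγ => ?_⟩⟩
  · obtain ⟨γ', hγ', hl⟩ := h C γ hγ
    exact ⟨γ', hγ', fun o Y c => (hl o Y c).symm⟩
  · obtain ⟨γ', hγ', hl⟩ := h' C γ hγ.2
    exact ⟨γ', ⟨hγ.1, hγ'⟩, hl⟩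
  · obtain ⟨γ', hγ', hl⟩ := h C γ hγ.2
    exact ⟨γ', ⟨hγ.1, hγ'⟩, fun o Y c => (hl o Y c).symm⟩

end Transfer

/-! ### Graded and Presburger logic as counting logics -/

section Instances

variable (ρ : Type)

theorem isCountingLogic_graded : IsCountingLogic (Λ := gradedSig ρ) (fun o => o.1) (fun _ _ => 1)
    (fun o => o.2 + 1) (fun r m => (r, m)) (gradedAx ρ) where
  ar_pos _ := Nat.one_pos
  rules := rfl
  bound := rfl
  coeff_pos _ _ := Nat.one_pos
  role_dia _ _ := rfl
  coeff_dia _ _ := Fin.sum_univ_one fun _ => 1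
  thr_dia _ _ := rfl

theorem isCountingLogic_pres : IsCountingLogic (Λ := presSig ρ) (fun o => o.role)
    (fun o s => (o.coeff s : ℕ)) (fun o => o.thr) (fun r m => ⟨r, 0, fun _ => 1, m + 1⟩)
    (presAx ρ) where
  ar_pos _ := Nat.succ_pos _
  rules := rfl
  bound := rfl
  coeff_pos o s := (o.coeff s).pos
  role_dia _ _ := rfl
  coeff_dia _ _ := Fin.sum_univ_one fun _ => ((1 : ℕ+) : ℕ)
  thr_dia _ _ := rfl

theorem mem_lifting_graded {X : Type u} (B : ρ → X → ℕ∞) (o : (gradedSig ρ).Op)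
    (Y : Fin ((gradedSig ρ).ar o) → Set X) :
    (B ∈ (countingSem.{u} (Λ := gradedSig ρ) (fun o => o.1) (fun _ _ => 1)
      (fun o => o.2 + 1)).lifting o Y) ↔ B ∈ (gradedSem.{u} ρ).lifting o Y := by
  change ((o.2 + 1 : ℕ) : ℕ∞) ≤ ∑ s : Fin 1, ((1 : ℕ) : ℕ∞) * weight (B o.1) (Y s) ↔
    (o.2 : ℕ∞) < weight (B o.1) (Y (0 : Fin 1))
  rw [Fin.sum_univ_one]
  push_cast
  rw [one_mul, ENat.natCast_add_one_le_iff]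

variable [Countable ρ] {ρ} {b : Bool}

theorem stronglyCompleteFor_graded (A : Set (Form (gradedSig ρ) b 0)) (hA : ∀ α ∈ A, α.IsPure) :
    StronglyCompleteFor (gradedSem.{u} ρ) (gradedAx ρ) A
      (fun _ γ => IsFrame (gradedSem ρ) γ A) := by
  have : Countable (gradedSig ρ).Op := inferInstanceAs (Countable (ρ × ℕ))
  have hl : ∀ (C : Type u) (γ : C → ρ → C → ℕ∞) (o : (gradedSig ρ).Op) Y c, _ :=
    fun C γ o Y c => mem_lifting_graded ρ (γ c) o Y
  have h := (isCountingLogic_graded ρ).stronglyCompleteFor.{u} hA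
  exact StronglyCompleteFor.transfer (S := countingSem.{u} (Λ := gradedSig ρ) (fun o => o.1)
    (fun _ _ => 1) (fun o => o.2 + 1)) (S' := gradedSem ρ)
    (fun C γ hγ => ⟨γ, (isFrame_iff_of_lifting (hl C γ) A).1 hγ, hl C γ⟩)
    (fun C γ hγ => ⟨γ, (isFrame_iff_of_lifting (hl C γ) A).2 hγ, hl C γ⟩) h

instance : Countable (PresOp ρ) := by
  have : Function.Injective (fun o : PresOp ρ =>
      ((⟨o.n, o.coeff⟩, o.role, o.thr) : (Σ n, Fin (n + 1) → ℕ+) × ρ × ℕ)) := by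
    rintro ⟨r, n, a, k⟩ ⟨r', n', a', k'⟩ h
    simp only [Prod.mk.injEq, Sigma.mk.injEq] at h
    obtain ⟨⟨rfl, h⟩, rfl, rfl⟩ := h
    rw [eq_of_heq h]
  exact this.countable

theorem stronglyCompleteFor_pres (A : Set (Form (presSig ρ) b 0)) (hA : ∀ α ∈ A, α.IsPure) :
    StronglyCompleteFor (presSem.{u} ρ) (presAx ρ) A (fun _ γ => IsFrame (presSem ρ) γ A) := by
  have : Countable (presSig ρ).Op := inferInstanceAs (Countable (PresOp ρ))
  exact (isCountingLogic_pres ρ).stronglyCompleteFor hA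

end Instances

/-! ### Frame classes defined by pure axioms -/

section FrameClasses

variable {ρ : Type} {Λ : SimType} {b : Bool}

theorem ENat.le_of_forall_natCast_lt {x y : ℕ∞} (h : ∀ k : ℕ, (k : ℕ∞) < x → (k : ℕ∞) < y) :
    x ≤ y := by
  by_contra hyx
  rw [not_le] at hyx
  obtain ⟨k, rfl⟩ := ENat.ne_top_iff_exists.1 hyx.ne_top
  exact lt_irrefl _ (h k hyx)

/-- The formula `⟨k⟩_r i` says that the multiplicity of the edge to `i` exceeds `k`, so letting `k`
vary compares multiplicities exactly. Abstracting the truth relation as `H` serves both logics. -/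
theorem definesFrameClasses_of_dia (dia : ρ → ℕ → Form Λ b 0 → Form Λ b 0)
    (frame : ∀ {C : Type u}, (C → ρ → C → ℕ∞) → Set (Form Λ b 0) → Prop)
    (H : ∀ {C : Type u}, (C → ρ → C → ℕ∞) → (ℕ → Set C) → (ℕ → C) → Form Λ b 0 → C → Prop)
    (hframe : ∀ {C : Type u} (γ : C → ρ → C → ℕ∞) A,
      frame γ A ↔ ∀ V ν, ∀ α ∈ A, ∀ c, H γ V ν α c)
    (hval : ∀ {C : Type u} (γ : C → ρ → C → ℕ∞) V ν c, IsVal fun φ => H γ V ν φ c)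
    (hnom : ∀ {C : Type u} (γ : C → ρ → C → ℕ∞) V ν i c, H γ V ν (nom i) c ↔ c = ν i)
    (hat : ∀ {C : Type u} (γ : C → ρ → C → ℕ∞) V ν i φ c,
      H γ V ν (atN i φ) c ↔ H γ V ν φ (ν i))
    (hdia : ∀ {C : Type u} (γ : C → ρ → C → ℕ∞) V ν r (k : ℕ) φ c,
      H γ V ν (dia r k φ) c ↔ (k : ℕ∞) < weight (γ c r) {d | H γ V ν φ d})
    (hpure : ∀ r k φ, IsPure φ → IsPure (dia r k φ)) :
    DefinesFrameClasses.{u} dia frame := by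
  intro r
  refine ⟨?_, fun C γ => ?_⟩
  · have hn : ∀ i, IsPure (nom i : Form Λ b 0) := fun _ => trivial
    rintro α (((rfl | rfl) | ⟨n, rfl⟩) | ⟨k, rfl⟩)
    · exact hpure _ _ _ (hn 0)
    · exact ⟨hn 0, hpure _ _ _ (hn 0)⟩
    · exact ⟨hpure _ _ _ (hpure _ _ _ (hn 0)), hpure _ _ _ (hn 0)⟩
    · exact ⟨⟨hn 0, hpure _ _ _ (hn 1)⟩, hpure _ _ _ (hn 0)⟩
  have hdn : ∀ V ν i (k : ℕ) c, H γ V ν (dia r k (nom i)) c ↔ (k : ℕ∞) < γ c r (ν i) := by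
    intro V ν i k c
    have : {d | H γ V ν (nom i) d} = {ν i} := Set.ext fun d => hnom γ V ν i d
    rw [hdia, this, weight_singleton]
  simp only [hframe]
  refine ⟨?_, ?_, ?_, ?_⟩
  · simp only [kripkeAx, Set.mem_singleton_iff, forall_eq, (hval γ _ _ _).neg, hdn, not_lt]
    exact ⟨fun h c d => h (fun _ => ∅) (fun _ => d) c, fun h V ν c => h c (ν 0)⟩
  · simp only [reflAx, Set.mem_singleton_iff, forall_eq, (hval γ _ _ _).imp, hdn, hnom,
      Nat.cast_zero]
    exact ⟨fun h c => h (fun _ => ∅) (fun _ => c), fun h V ν => h (ν 0)⟩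
  · simp only [transAx, Set.mem_range, forall_exists_index, forall_apply_eq_imp_iff,
      (hval γ _ _ _).imp, hdn, hdia, Nat.cast_zero, weight_pos]
    constructor
    · intro h c d e hcd
      exact ENat.le_of_forall_natCast_lt fun k hk =>
        h (fun _ => ∅) (fun _ => e) k c d ⟨hk, hcd⟩
    · rintro h V ν n c d ⟨hd, hcd⟩
      exact lt_of_lt_of_le hd (h c d (ν 0) hcd)
  · simp only [symmAx, Set.mem_range, forall_exists_index, forall_apply_eq_imp_iff,
      (hval γ _ _ _).imp, (hval γ _ _ _).and, hat, hdn, hnom]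
    constructor
    · intro h
      have key : ∀ c d, γ c r d ≤ γ d r c := fun c d =>
        ENat.le_of_forall_natCast_lt fun k hk =>
          h (fun _ => ∅) (fun i => if i = 0 then c else d) k c ⟨by simp, by simpa using hk⟩
      exact fun c d => le_antisymm (key c d) (key d c)
    · rintro h V ν k c ⟨rfl, hk⟩
      rwa [h]

theorem definesFrameClasses_graded :
    DefinesFrameClasses.{u} (gradedDia (ρ := ρ) (b := b))
      (fun γ A => IsFrame (gradedSem ρ) γ A) :=
  definesFrameClasses_of_dia _ _ (fun γ V ν φ c => Holds (gradedSem ρ) γ V ν φ c)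
    (fun _ _ => Iff.rfl) (fun γ V ν c => isVal_holds (gradedSem ρ) γ V ν c)
    (fun _ _ _ _ _ => Iff.rfl) (fun _ _ _ _ _ _ => Iff.rfl) (fun _ _ _ _ _ _ _ => Iff.rfl)
    (fun _ _ _ h _ => h)

theorem definesFrameClasses_pres :
    DefinesFrameClasses.{u} (presDia (ρ := ρ) (b := b))
      (fun γ A => IsFrame (presSem ρ) γ A) :=
  definesFrameClasses_of_dia _ _ (fun γ V ν φ c => Holds (presSem ρ) γ V ν φ c)
    (fun _ _ => Iff.rfl) (fun γ V ν c => isVal_holds (presSem ρ) γ V ν c)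
    (fun _ _ _ _ _ => Iff.rfl) (fun _ _ _ _ _ _ => Iff.rfl)
    (fun γ V ν r k φ c => by
      change ((k + 1 : ℕ) : ℕ∞) ≤ ∑ s : Fin 1, (((1 : ℕ+) : ℕ) : ℕ∞) *
        weight (γ c r) {d | Holds (presSem ρ) γ V ν φ d} ↔ _
      rw [Fin.sum_univ_one]
      push_cast
      rw [one_mul, ENat.natCast_add_one_le_iff])
    (fun _ _ _ h _ => h)

end FrameClasses

/-! ### Kripke frames, SHOQ concepts and role boxes -/

section Kripke

variable {ρ : Type} {b : Bool}

theorem natCast_lt_encard_inter_singleton {X : Type u} (s : Set X) (x : X) (k : ℕ) :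
    (k : ℕ∞) < (s ∩ {x}).encard ↔ k = 0 ∧ x ∈ s := by
  by_cases hx : x ∈ s
  · rw [Set.inter_eq_right.2 (by simpa using hx), Set.encard_singleton]
    simp [hx]
  · rw [Set.inter_singleton_eq_empty.2 hx]
    simp [hx]

open Classical in
theorem weight_indicator {X : Type u} (s Y : Set X) :
    weight (fun x => if x ∈ s then 1 else 0) Y = (s ∩ Y).encard := by
  refine le_antisymm (iSup₂_le fun F hF => ?_) ?_
  · rw [Finset.sum_boole, ← Set.encard_coe_eq_coe_finsetCard]
    refine Set.encard_le_encard fun x hx => ?_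
    have := Finset.mem_filter.1 (Finset.mem_coe.1 hx)
    exact ⟨this.2, hF this.1⟩
  · refine ENat.forall_natCast_le_iff_le.1 fun k hk => ?_
    obtain ⟨t, ht, htk⟩ := Set.exists_subset_encard_eq hk
    have hfin : t.Finite := Set.finite_of_encard_eq_coe htk
    rw [← htk, hfin.encard_eq_coe_toFinset_card]
    refine le_trans (le_of_eq ?_) (sum_le_weight _ hfin.toFinset fun x hx => ?_)
    · rw [Finset.sum_congr rfl fun x hx => if_pos (ht (hfin.mem_toFinset.1 hx)).1]
      simp
    · exact (ht (hfin.mem_toFinset.1 hx)).2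

theorem holds_toForm {C : Type u} (γ : C → ρ → Set C) (V : ℕ → Set C) (ν : ℕ → C)
    (E : SHOQConcept ρ) (c : C) :
    Holds (kripkeSem ρ) γ V ν (E.toForm : Form (gradedSig ρ) b 0) c ↔ c ∈ E.ext γ V ν := by
  have hv := fun c => isVal_holds (b := b) (kripkeSem ρ) γ V ν c
  have hd : ∀ r (k : ℕ) φ c, Holds (kripkeSem ρ) γ V ν (gradedDia r k φ : Form _ b 0) c ↔
      (k : ℕ∞) < (γ c r ∩ {d | Holds (kripkeSem ρ) γ V ν φ d}).encard :=
    fun _ _ _ _ => Iff.rfl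
  induction E generalizing c with
  | top => exact iff_of_true id trivial
  | bot => exact iff_of_false id id
  | atom p => exact Iff.rfl
  | one i => exact Iff.rfl
  | compl E ih => exact not_congr (ih c)
  | inter E E' ih ih' => exact and_congr (ih c) (ih' c)
  | union E E' ih ih' => exact ((hv c).or _ _).trans (or_congr (ih c) (ih' c))
  | ex r E ih =>
    simp only [SHOQConcept.toForm, hd, ih, Nat.cast_zero, Set.encard_pos]
    exact Iff.rfl
  | all r E ih =>
    simp only [SHOQConcept.toForm, (hv _).neg, hd, ih, Nat.cast_zero, Set.encard_pos]
    rw [Set.not_nonempty_iff_eq_empty, Set.eq_empty_iff_forall_notMem]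
    simp [SHOQConcept.ext]
  | atLeast n r E ih =>
    cases n with
    | zero => exact iff_of_true id (by simp [SHOQConcept.ext])
    | succ n =>
      simp only [SHOQConcept.toForm, hd, ih, SHOQConcept.ext, Set.mem_ofPred_eq]
      push_cast
      rw [ENat.natCast_add_one_le_iff]
      exact Iff.rfl
  | atMost n r E ih =>
    simp only [SHOQConcept.toForm, (hv _).neg, hd, ih, not_lt]
    exact Iff.rfl

theorem isPure_of_mem_roleBoxAx (R : Set (RoleAxiom ρ)) (α : Form (gradedSig ρ) b 0)
    (hα : α ∈ roleBoxAx R) : α.IsPure := by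
  have hn : ∀ i, IsPure (nom i : Form (gradedSig ρ) b 0) := fun _ => trivial
  have hd : ∀ r k (φ : Form (gradedSig ρ) b 0), φ.IsPure → (gradedDia r k φ).IsPure :=
    fun _ _ _ h _ => h
  rcases hα with hα | hα
  · obtain ⟨r, rfl⟩ := Set.mem_iUnion.1 hα
    exact hd _ _ _ (hn 0)
  · obtain ⟨a, ha, hα⟩ := Set.mem_iUnion₂.1 hα
    rcases a with ⟨r, s⟩ | r
    · obtain rfl := Set.mem_singleton_iff.1 hα
      exact ⟨hd _ _ _ (hn 0), hd _ _ _ (hn 0)⟩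
    · obtain ⟨n, rfl⟩ := hα
      exact ⟨hd _ _ _ (hd _ _ _ (hn 0)), hd _ _ _ (hn 0)⟩

theorem isFrame_union {Λ : SimType} {S : Sem.{u} Λ} {C : Type u} {γ : C → S.T C}
    {A A' : Set (Form Λ b 0)} : IsFrame S γ (A ∪ A') ↔ IsFrame S γ A ∧ IsFrame S γ A' := by
  unfold IsFrame
  refine ⟨fun h => ⟨fun V ν α hα => h V ν α (Or.inl hα), fun V ν α hα => h V ν α (Or.inr hα)⟩,
    fun h V ν α hα => ?_⟩
  rcases hα with hα | hα
  · exact h.1 V ν α hα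
  · exact h.2 V ν α hα

/-- Over Kripke frames `⟨k⟩_r i` fails for `k > 0` and says "`i` is a successor" for `k = 0`. The
transitivity axiom therefore has content only for `n = 0`. -/
theorem isFrame_roleBoxAx (R : Set (RoleAxiom ρ)) {C : Type u} (γ : C → ρ → Set C) :
    IsFrame (kripkeSem ρ) γ (roleBoxAx R : Set (Form (gradedSig ρ) b 0)) ↔
      ∀ a ∈ R, a.Respected γ := by
  have hv := fun V ν c => isVal_holds (b := b) (kripkeSem ρ) γ V ν c
  have hd : ∀ V ν r (k : ℕ) φ c, Holds (kripkeSem ρ) γ V ν (gradedDia r k φ : Form _ b 0) c ↔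
      (k : ℕ∞) < (γ c r ∩ {d | Holds (kripkeSem ρ) γ V ν φ d}).encard :=
    fun _ _ _ _ _ _ => Iff.rfl
  have hdn : ∀ V ν r (k i : ℕ) c, Holds (kripkeSem ρ) γ V ν
      (gradedDia r k (nom i) : Form _ b 0) c ↔ k = 0 ∧ ν i ∈ γ c r := fun V ν r k i c =>
    natCast_lt_encard_inter_singleton _ _ _
  constructor
  · intro h a ha
    have h' : ∀ V ν, ∀ α ∈ (a.axioms : Set (Form (gradedSig ρ) b 0)), ∀ c,
        Holds (kripkeSem ρ) γ V ν α c := fun V ν α hα =>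
      h V ν α (Or.inr (Set.mem_iUnion₂.2 ⟨a, ha, hα⟩))
    rcases a with ⟨r, s⟩ | r
    · intro c d hd'
      have := ((hv _ _ _).imp _ _).1 (h' (fun _ => ∅) (fun _ => d) _ rfl c)
        ((hdn _ _ _ _ _ _).2 ⟨rfl, hd'⟩)
      exact ((hdn _ _ _ _ _ _).1 this).2
    · intro c d e hcd hde
      have := ((hv _ _ _).imp _ _).1 (h' (fun _ => ∅) (fun _ => e) _ ⟨0, rfl⟩ c)
        ((hd _ _ _ _ _ _).2 (by
          rw [Nat.cast_zero, Set.encard_pos]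
          exact ⟨d, hcd, (hdn _ _ _ _ _ _).2 ⟨rfl, hde⟩⟩))
      exact ((hdn _ _ _ _ _ _).1 this).2
  · rintro h V ν α (hα | hα) c
    · obtain ⟨r, rfl⟩ := Set.mem_iUnion.1 hα
      rw [(hv _ _ _).neg, hdn]
      simp
    · obtain ⟨a, ha, hα⟩ := Set.mem_iUnion₂.1 hα
      have ha' := h a ha
      rcases a with ⟨r, s⟩ | r
      · obtain rfl := Set.mem_singleton_iff.1 hα
        rw [(hv _ _ _).imp, hdn, hdn]
        exact fun hc => ⟨rfl, ha' c hc.2⟩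
      · obtain ⟨n, rfl⟩ := hα
        rw [(hv _ _ _).imp, hdn, hd, Nat.cast_zero, Set.encard_pos]
        rintro ⟨d, hcd, hde⟩
        have hde' := (hdn _ _ _ _ _ _).1 hde
        exact ⟨hde'.1, ha' c d _ hcd hde'.2⟩

/-- A Kripke frame is a multigraph with multiplicities 0 and 1, via indicator functions, and
`kripkeAx` forces this form. The graded theorem for `roleBoxAx R ∪ A` thus transfers. -/
theorem stronglyCompleteFor_kripke [Countable ρ] (R : Set (RoleAxiom ρ))
    (A : Set (Form (gradedSig ρ) b 0)) (hA : ∀ α ∈ A, α.IsPure) :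
    StronglyCompleteFor (kripkeSem.{u} ρ) (gradedAx ρ) (roleBoxAx R ∪ A)
      (fun _ γ => (∀ a ∈ R, a.Respected γ) ∧ IsFrame (kripkeSem ρ) γ A) := by
  classical
  have hpure : ∀ α ∈ roleBoxAx R ∪ A, α.IsPure := fun α hα =>
    hα.elim (isPure_of_mem_roleBoxAx R α) (hA α)
  have hl : ∀ {X : Type u} (B : ρ → Set X) (o : (gradedSig ρ).Op)
      (Y : Fin ((gradedSig ρ).ar o) → Set X),
      (fun r x => if x ∈ B r then 1 else 0) ∈ (gradedSem.{u} ρ).lifting o Y ↔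
        B ∈ (kripkeSem.{u} ρ).lifting o Y := by
    intro X B o Y
    change (o.2 : ℕ∞) < weight (fun x => if x ∈ B o.1 then 1 else 0) (Y (0 : Fin 1)) ↔
      (o.2 : ℕ∞) < (B o.1 ∩ Y (0 : Fin 1)).encard
    rw [weight_indicator]
  have hK : ∀ (C : Type u) (γ : C → ρ → Set C), ((∀ a ∈ R, a.Respected γ) ∧
      IsFrame (kripkeSem ρ) γ A) ↔ IsFrame (kripkeSem ρ) γ (roleBoxAx R ∪ A) := fun C γ =>
    (and_congr_left' (isFrame_roleBoxAx R γ).symm).trans isFrame_union.symm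
  refine (stronglyCompleteFor_graded _ hpure).transfer (fun C γ hγ => ?_) (fun C γ hγ => ?_)
  · have hle : ∀ c r d, γ c r d ≤ 1 := fun c r d =>
      (((definesFrameClasses_graded (ρ := ρ) (b := b) r).2 C γ).1.1 (fun V ν α hα c =>
        hγ V ν α (Or.inl (Or.inl (Set.mem_iUnion.2 ⟨r, hα⟩))) c)) c d
    obtain ⟨γ', hγ'⟩ : ∃ γ' : C → ρ → Set C, ∀ c, γ c = fun r d => if d ∈ γ' c r then 1 else 0 := by
      refine ⟨fun c r => {d | γ c r d ≠ 0}, fun c => funext fun r => funext fun d => ?_⟩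
      rcases Order.le_one_iff.1 (hle c r d) with h | h <;> simp [h]
    have hl' : ∀ (o : (gradedSig ρ).Op) Y c, γ c ∈ (gradedSem.{u} ρ).lifting o Y ↔
        γ' c ∈ (kripkeSem.{u} ρ).lifting o Y := fun o Y c =>
      (iff_of_eq (congrArg (· ∈ (gradedSem.{u} ρ).lifting o Y) (hγ' c))).trans (hl (γ' c) o Y)
    exact ⟨γ', (hK C γ').2 ((isFrame_iff_of_lifting hl' _).1 hγ), hl'⟩
  · exact ⟨fun c r d => if d ∈ γ c r then 1 else 0,
      (isFrame_iff_of_lifting (fun o Y c => hl (γ c) o Y) _).2 ((hK C γ).1 hγ),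
      fun o Y c => hl (γ c) o Y⟩

end Kripke

end HybridLogic

theorem mainTheorem5 (ρ : Type) [Countable ρ] (b : Bool) :
    -- pure extensions of graded hybrid logic over multigraphs
    (∀ A : Set (Form (gradedSig ρ) b 0), (∀ α ∈ A, α.IsPure) →
      StronglyCompleteFor (gradedSem.{u} ρ) (gradedAx ρ) A
        (fun _ γ => IsFrame (gradedSem ρ) γ A)) ∧
    -- pure extensions of positive Presburger hybrid logic over multigraphs
    (∀ A : Set (Form (presSig ρ) b 0), (∀ α ∈ A, α.IsPure) →
      StronglyCompleteFor (presSem.{u} ρ) (presAx ρ) A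
        (fun _ γ => IsFrame (presSem ρ) γ A)) ∧
    -- frame classes defined by pure axioms, in both logics
    DefinesFrameClasses.{u} (gradedDia (ρ := ρ) (b := b))
      (fun γ A => IsFrame (gradedSem ρ) γ A) ∧
    DefinesFrameClasses.{u} (presDia (ρ := ρ) (b := b))
      (fun γ A => IsFrame (presSem ρ) γ A) ∧
    -- the extension of SHOQ: it contains the SHOQ concepts, role boxes are defined by pure axioms,
    -- and the axiomatization is complete over interpretations that respect a given role box
    (∀ (C : Type u) (γ : C → ρ → Set C) (V : ℕ → Set C) (ν : ℕ → C) (D : SHOQConcept ρ) (c : C),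
      Holds (kripkeSem ρ) γ V ν (D.toForm : Form (gradedSig ρ) b 0) c ↔ c ∈ D.ext γ V ν) ∧
    (∀ H : Set (RoleAxiom ρ),
      (∀ α ∈ (roleBoxAx H : Set (Form (gradedSig ρ) b 0)), α.IsPure) ∧
      (∀ (C : Type u) (γ : C → ρ → Set C),
        IsFrame (kripkeSem ρ) γ (roleBoxAx H : Set (Form (gradedSig ρ) b 0)) ↔
          ∀ a ∈ H, a.Respected γ) ∧
      (∀ A : Set (Form (gradedSig ρ) b 0), (∀ α ∈ A, α.IsPure) →
        StronglyCompleteFor (kripkeSem.{u} ρ) (gradedAx ρ) (roleBoxAx H ∪ A)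
          (fun _ γ => (∀ a ∈ H, a.Respected γ) ∧ IsFrame (kripkeSem ρ) γ A))) := by
  exact ⟨stronglyCompleteFor_graded, stronglyCompleteFor_pres, definesFrameClasses_graded,
    definesFrameClasses_pres, fun C γ V ν E c => holds_toForm γ V ν E c, fun H =>
    ⟨isPure_of_mem_roleBoxAx H, fun C γ => isFrame_roleBoxAx H γ,
      fun A hA => stronglyCompleteFor_kripke H A hA⟩⟩
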